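/- Let $n\ge 2$ be even and let $q_1,\dots,q_n$ be odd integers (of either sign). The pretzel link $L=P(q_1,\dots,q_n)$ is given by its standard diagram: $n$ vertical twist regions side by side, the $i$-th having $|q_i|$ crossings (half-twists) whose handedness is given by the sign of $q_i$; the two top ends and the two bottom ends of each twist region are joined to the top ends and the bottom ends of the neighbouring regions, cyclically. (For $n$ even and all $q_i$ odd, $L$ has exactly two components.) Orient $L$. The Alexander polynomial $\Delta_L(t)\in\mathbb Z[t,t^{-1}]$ is defined up to units $\pm t^k$ as follows. The Alexander matrix of an oriented diagram has one column for each arc and one row for each crossing; the row of a crossing is the relation $(1-t)x+ty-z$, where $x$ is the overpassing arc, and $y$ and $z$ are the arcs that end at the crossing on the left and on the right of $x$. If the diagram has $a$ arcs, $\Delta_L(t)$ is the greatest common divisor of the $(a-1)\times(a-1)$ minors of this matrix. Write $f\doteq g$ if $f=\pm t^k g$ for some $k\in\mathbb Z$, and let $\sigma_j(q_1,\dots,q_n)$ be the $j$-th elementary symmetric polynomial. 1. If the two strands in each twist region are co-directed (both run upwards or both run downwards), then $$\Delta_L(t)\doteq\frac{1}{(1+t)^{n-1}}\prod_{i=1}^n\left(1+t^{q_i}\right)\left(\sum_{i=1}^n\frac{t^{q_i}}{1+t^{q_i}}-\frac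 n2\right).$$ 2. If the two strands in each twist region are oppositely directed, then $$\Delta_L(t)\doteq\frac{1}{2^{n-1}}\sum_{k=1}^{n/2}(t-1)^{2k-1}(t+1)^{n-2k}\,\sigma_{2k-1}(q_1,\dots,q_n).$$ -/

import Mathlib

open scoped LaurentPolynomial

/-- The combinatorial code of an (unoriented) link diagram.  Around every crossing `c` there are
four half-edges `(c, 0), (c, 1), (c, 2), (c, 3)`, listed in counterclockwise order; `(c, k)` and
`(c, k + 2)` belong to the same strand through `c`.  `glue` pairs the half-edges that are the two
ends of an edge of the diagram.  The strand through `(c, overCorner c)` and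
`(c, overCorner c + 2)` is the
overstrand at `c`, the other one is the understrand.  A diagram drawn in the
plane, every component of which has a crossing, gives such a code (planarity is not recorded: the
Alexander matrix below does not refer to it). -/
structure LinkDiagram where
  /-- the crossings -/
  Crossing : Type
  finite_crossing : Finite Crossing
  /-- the other end of the edge on which a half-edge lies -/
  glue : Crossing × Fin 4 → Crossing × Fin 4
  glue_glue : ∀ h, glue (glue h) = h
  glue_ne : ∀ h, glue h ≠ h
  /-- one of the two half-edges of the overstrand -/
  overCorner : Crossing → Fin 4

namespace LinkDiagram

attribute [instance] LinkDiagram.finite_crossing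

/-- The half-edges of a diagram. -/
abbrev HalfEdge (D : LinkDiagram) : Type := D.Crossing × Fin 4

/-- An orientation of the link: it says of every half-edge whether the strand there runs away
from its crossing (`true`) or into it (`false`), consistently along edges and through crossings. -/
structure Orientation (D : LinkDiagram) where
  outgoing : D.HalfEdge → Bool
  outgoing_glue : ∀ h, outgoing (D.glue h) = !(outgoing h)
  outgoing_opposite : ∀ c k, outgoing (c, k + 2) = !(outgoing (c, k))

/-- Two half-edges that are the ends of one edge, or the two halves of an overstrand. -/
inductive ArcRel (D : LinkDiagram) : D.HalfEdge → D.HalfEdge → Prop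
  | edge (h : D.HalfEdge) : ArcRel D h (D.glue h)
  | overpass (c : D.Crossing) : ArcRel D (c, D.overCorner c) (c, D.overCorner c + 2)

/-- The arcs of the diagram: the pieces into which it is cut at its undercrossings. -/
def Arc (D : LinkDiagram) : Type := Quot D.ArcRel

/-- The arc that contains a half-edge. -/
def arc (D : LinkDiagram) (h : D.HalfEdge) : D.Arc := Quot.mk D.ArcRel h

instance (D : LinkDiagram) : Finite D.Arc :=
  Finite.of_surjective D.arc Quot.mk_surjective

noncomputable instance (D : LinkDiagram) : Fintype D.Arc := Fintype.ofFinite _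

noncomputable instance (D : LinkDiagram) : DecidableEq D.Arc := Classical.decEq _

/-- The half-edge by which the oriented overstrand leaves the crossing `c`. -/
def overOut (D : LinkDiagram) (o : D.Orientation) (c : D.Crossing) : Fin 4 :=
  if o.outgoing (c, D.overCorner c) then D.overCorner c else D.overCorner c + 2

/-- The Alexander matrix of an oriented diagram: a column for every arc and a row for every
crossing, the row of a crossing being the relation `(1 - t) x + t y - z`, where `x` is the
overpassing arc, `y` the arc that ends at the crossing on the left of `x`, and `z` the one that
ends there on the right (coefficients add up when arcs coincide).  It comes from the Wirtinger
presentation of the link group by Fox calculus, all meridians being sent to `t`. -/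
noncomputable def alexanderMatrix (D : LinkDiagram) (o : D.Orientation) :
    Matrix D.Crossing D.Arc ℤ[T;T⁻¹] := fun c =>
  Pi.single (D.arc (c, D.overOut o c)) (1 - LaurentPolynomial.T 1)
    + Pi.single (D.arc (c, D.overOut o c + 1)) (LaurentPolynomial.T 1)
    - Pi.single (D.arc (c, D.overOut o c + 3)) 1

/-- The minors of the Alexander matrix whose size is one less than the number of arcs: the column
`j` is deleted, and `r` lists the rows. -/
noncomputable def alexanderMinor (D : LinkDiagram) (o : D.Orientation) (j : D.Arc)
    (r : {s : D.Arc // s ≠ j} → D.Crossing) : ℤ[T;T⁻¹] :=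
  ((D.alexanderMatrix o).submatrix r Subtype.val).det

/-- `Δ` is a greatest common divisor of the minors above, in the ring of Laurent polynomials. -/
def IsAlexanderPolynomial (D : LinkDiagram) (o : D.Orientation) (Δ : ℤ[T;T⁻¹]) : Prop :=
  (∀ j r, Δ ∣ D.alexanderMinor o j r) ∧ ∀ g, (∀ j r, g ∣ D.alexanderMinor o j r) → g ∣ Δ

theorem exists_gcd_of_finite {R ι : Type*} [CommRing R] [IsDomain R]
    [UniqueFactorizationMonoid R] [Finite ι] (f : ι → R) :
    ∃ d, (∀ i, d ∣ f i) ∧ ∀ g, (∀ i, g ∣ f i) → g ∣ d := by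
  classical
  have := Fintype.ofFinite ι
  let := UniqueFactorizationMonoid.toGCDMonoid R
  suffices h : ∀ s : Finset ι, ∃ d, (∀ i ∈ s, d ∣ f i) ∧ ∀ g, (∀ i ∈ s, g ∣ f i) → g ∣ d by
    simpa using h Finset.univ
  intro s
  induction s using Finset.induction_on with
  | empty => exact ⟨0, by simp, by simp⟩
  | insert a s _ ih =>
    obtain ⟨d, h1, h2⟩ := ih
    refine ⟨gcd (f a) d, ?_, ?_⟩
    · intro i hi
      rcases Finset.mem_insert.mp hi with rfl | hi
      · exact gcd_dvd_left _ _
      · exact (gcd_dvd_right _ _).trans (h1 i hi)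
    · intro g hg
      exact dvd_gcd (hg a (Finset.mem_insert_self _ _))
        (h2 g fun i hi => hg i (Finset.mem_insert_of_mem hi))

theorem exists_isAlexanderPolynomial (D : LinkDiagram) (o : D.Orientation) :
    ∃ Δ, D.IsAlexanderPolynomial o Δ := by
  have : UniqueFactorizationMonoid ℤ[T;T⁻¹] :=
    UniqueFactorizationMonoid.of_isLocalization
      (Submonoid.powers (Polynomial.X : Polynomial ℤ)) ℤ[T;T⁻¹]
  obtain ⟨d, h1, h2⟩ := exists_gcd_of_finite
    (fun p : Σ j : D.Arc, ({s : D.Arc // s ≠ j} → D.Crossing) => D.alexanderMinor o p.1 p.2)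
  exact ⟨d, fun j r => h1 ⟨j, r⟩, fun g hg => h2 g fun p => hg p.1 p.2⟩

/-- The (one-variable) Alexander polynomial of an oriented link diagram, well defined up to units
of `ℤ[T;T⁻¹]`, that is, up to factors `± T k`: the greatest common divisor of the minors of the
Alexander matrix whose size is one less than the number of arcs. -/
noncomputable def alexanderPolynomial (D : LinkDiagram) (o : D.Orientation) : ℤ[T;T⁻¹] :=
  (D.exists_isAlexanderPolynomial o).choose

theorem alexanderPolynomial_spec (D : LinkDiagram) (o : D.Orientation) :
    D.IsAlexanderPolynomial o (D.alexanderPolynomial o) :=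
  (D.exists_isAlexanderPolynomial o).choose_spec

end LinkDiagram

/-- Gluing of the standard diagram of a pretzel link.  The crossing `⟨i, j⟩` is the `j`-th one from
the top in the `i`-th vertical twist region, its half-edges `0, 1, 2, 3` point to the
north-west, south-west, south-east and north-east.  Consecutive crossings of a twist region
are joined vertically; the two top ends and the two bottom ends of a twist region are joined to the
top ends and the bottom ends of the neighbouring regions, cyclically. -/
def pretzelGlue {n : ℕ} (q : Fin n → ℤ) (hq : ∀ i, q i ≠ 0) :
    (Σ i, Fin (q i).natAbs) × Fin 4 → (Σ i, Fin (q i).natAbs) × Fin 4 :=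
  let first : Fin n → Σ i, Fin (q i).natAbs := fun i =>
    ⟨i, ⟨0, Int.natAbs_pos.mpr (hq i)⟩⟩
  let last : Fin n → Σ i, Fin (q i).natAbs := fun i =>
    ⟨i, ⟨(q i).natAbs - 1, Nat.sub_one_lt (Int.natAbs_ne_zero.mpr (hq i))⟩⟩
  fun
  | (⟨i, j⟩, 0) =>
      if (j : ℕ) = 0 then (first ((finRotate n).symm i), 3)
      else (⟨i, ⟨j - 1, lt_of_le_of_lt (Nat.sub_le _ _) j.2⟩⟩, 1)
  | (⟨i, j⟩, 1) =>
      if h : (j : ℕ) + 1 < (q i).natAbs then (⟨i, ⟨j + 1, h⟩⟩, 0)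
      else (last ((finRotate n).symm i), 2)
  | (⟨i, j⟩, 2) =>
      if h : (j : ℕ) + 1 < (q i).natAbs then (⟨i, ⟨j + 1, h⟩⟩, 3)
      else (last (finRotate n i), 1)
  | (⟨i, j⟩, 3) =>
      if (j : ℕ) = 0 then (first (finRotate n i), 0)
      else (⟨i, ⟨j - 1, lt_of_le_of_lt (Nat.sub_le _ _) j.2⟩⟩, 2)

theorem pretzelGlue_snd {n : ℕ} (q : Fin n → ℤ) (hq : ∀ i, q i ≠ 0) (h) :
    (pretzelGlue q hq h).2 ≠ h.2 := by
  obtain ⟨⟨i, j⟩, k⟩ := h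
  fin_cases k <;> simp only [pretzelGlue] <;> split_ifs <;> simp

theorem pretzelGlue_pretzelGlue {n : ℕ} (q : Fin n → ℤ) (hq : ∀ i, q i ≠ 0) (h) :
    pretzelGlue q hq (pretzelGlue q hq h) = h := by
  obtain ⟨⟨i, j, hj⟩, k⟩ := h
  have hpos := Int.natAbs_pos.mpr (hq i)
  fin_cases k
  · by_cases h0 : j = 0
    · subst h0
      simp [-finRotate_apply, -finRotate_symm_apply, pretzelGlue]
      exact (Fin.heq_ext_iff (by
        simp [-finRotate_apply, -finRotate_symm_apply])).mpr (by
        simp [-finRotate_apply, -finRotate_symm_apply])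
    · have : j - 1 + 1 = j := by omega
      simp [-finRotate_apply, -finRotate_symm_apply, pretzelGlue, h0, this, hj]
  · by_cases h0 : j + 1 < (q i).natAbs
    · simp [-finRotate_apply, -finRotate_symm_apply, pretzelGlue, h0]
    · have h1 : j = (q i).natAbs - 1 := by omega
      subst h1
      have hh : ∀ i', (q i').natAbs - 1 + 1 = (q i').natAbs := fun i' => by
        have := Int.natAbs_pos.mpr (hq i'); omega
      simp [-finRotate_apply, -finRotate_symm_apply, pretzelGlue, hh]
      exact (Fin.heq_ext_iff (by
        simp [-finRotate_apply, -finRotate_symm_apply])).mpr (by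
        simp [-finRotate_apply, -finRotate_symm_apply])
  · by_cases h0 : j + 1 < (q i).natAbs
    · simp [-finRotate_apply, -finRotate_symm_apply, pretzelGlue, h0]
    · have h1 : j = (q i).natAbs - 1 := by omega
      subst h1
      have hh : ∀ i', (q i').natAbs - 1 + 1 = (q i').natAbs := fun i' => by
        have := Int.natAbs_pos.mpr (hq i'); omega
      simp [-finRotate_apply, -finRotate_symm_apply, pretzelGlue, hh]
      exact (Fin.heq_ext_iff (by
        simp [-finRotate_apply, -finRotate_symm_apply])).mpr (by
        simp [-finRotate_apply, -finRotate_symm_apply])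
  · by_cases h0 : j = 0
    · subst h0
      simp [-finRotate_apply, -finRotate_symm_apply, pretzelGlue]
      exact (Fin.heq_ext_iff (by
        simp [-finRotate_apply, -finRotate_symm_apply])).mpr (by
        simp [-finRotate_apply, -finRotate_symm_apply])
    · have : j - 1 + 1 = j := by omega
      simp [-finRotate_apply, -finRotate_symm_apply, pretzelGlue, h0, this, hj]

/-- The standard diagram of the pretzel link `P(q₁, …, qₙ)`, all `qᵢ` being nonzero: `n` vertical
twist regions side by side, the `i`-th with `|qᵢ|` crossings, whose overstrands run from south-west
to north-east if `qᵢ > 0` and from north-west to south-east if `qᵢ < 0`. -/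
def pretzelDiagram {n : ℕ} (q : Fin n → ℤ) (hq : ∀ i, q i ≠ 0) : LinkDiagram where
  Crossing := Σ i, Fin (q i).natAbs
  finite_crossing := inferInstance
  glue := pretzelGlue q hq
  glue_glue := pretzelGlue_pretzelGlue q hq
  glue_ne h e := pretzelGlue_snd q hq h (congrArg Prod.snd e)
  overCorner c := if 0 < q c.1 then 1 else 0

/-- In every twist region the two strands run in the same vertical direction: at each crossing,
the strands at the north-west and at the north-east both leave or both arrive. -/
def PretzelCoDirected {n : ℕ} (q : Fin n → ℤ) (hq : ∀ i, q i ≠ 0)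
    (o : (pretzelDiagram q hq).Orientation) : Prop :=
  ∀ c : (pretzelDiagram q hq).Crossing, o.outgoing (c, 0) = o.outgoing (c, 3)

/-- In every twist region the two strands run in opposite vertical directions. -/
def PretzelOppositelyDirected {n : ℕ} (q : Fin n → ℤ) (hq : ∀ i, q i ≠ 0)
    (o : (pretzelDiagram q hq).Orientation) : Prop :=
  ∀ c : (pretzelDiagram q hq).Crossing, o.outgoing (c, 0) ≠ o.outgoing (c, 3)

/-- The field of fractions of the ring of Laurent polynomials over `ℤ`, in which the closed
formulas are written. -/
abbrev LaurentFrac : Type := FractionRing ℤ[T;T⁻¹]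

/-- The variable `t`. -/
noncomputable def tVar : LaurentFrac := algebraMap ℤ[T;T⁻¹] LaurentFrac (LaurentPolynomial.T 1)

/-- Equality up to multiplication by `± t ^ k` with an integer `k`. -/
def DotEq (f g : LaurentFrac) : Prop :=
  ∃ k : ℤ, f = tVar ^ k * g ∨ f = -(tVar ^ k * g)

/-- The elementary symmetric polynomial `σₖ(q₁, …, qₙ)`. -/
def sigmaSym {n : ℕ} (k : ℕ) (q : Fin n → ℤ) : ℤ :=
  ∑ s ∈ Finset.powersetCard k (Finset.univ : Finset (Fin n)), ∏ i ∈ s, q i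

/-! Work with colorings: labels of the half-edges in a module over the Laurent polynomials, constant
on arcs and satisfying the Alexander relation at each crossing. Let `d i` be the difference of the
two labels at the top of the twist region `i`. Going down the region, each label changes by a
multiple of `d i`; let `L i` and `R i` (`leftTotal`, `rightTotal`) be the total multiples on the
left and right strands. Then a coloring, up to an additive constant, is the same as a family `d`
with `∑ d i = 0` (top arcs close up) and `R i • d i = L (i+1) • d (i+1)` cyclically (bottom arcs
match).

One cyclic relation is redundant: there are weights with `v (i+1) = w i` for which `w i * R i - v i
* L i` is a constant `κ`, so the weighted sum of the cyclic relations is `κ • ∑ d i`. The remaining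
relations form a square matrix `chainMatrix`, presenting the same module as the Alexander matrix
with one column deleted. By the invariance of the gcd of maximal minors (`det_isGCD_minors`), its
determinant, which is `chainSum` up to sign, is the Alexander polynomial
(`det_chainMatrix_isAlexanderPolynomial`).

Co-directed strands give geometric sums, with `R i = -t^s * L i` where `s = ±1` alternates between
neighbouring regions. Here `κ = 0`, and `chainSum` is a product times a sum of reciprocals.
Oppositely directed strands give `L i` and `R i` equal to `(q i * (x - 1) ∓ (x + 1)) / 2` with `x =
t^(±1)`. Here the weights are `1` and `κ = x + 1`, so `κ * chainSum = ∏ R i - ∏ L i`, which expands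
into the odd elementary symmetric polynomials. -/

open scoped LaurentPolynomial

/-! ### Maximal minors and change of presentation. -/

section Fitting

variable {R : Type*} [CommRing R]

/-- A weak Cauchy–Binet: the rows of `W * B` are combinations of rows of `B`, so multilinearity
writes the determinant as a combination of minors, repeated rows being allowed. -/
theorem dvd_det_mul_of_forall_dvd_det_submatrix {m k : Type*} [Fintype m] [DecidableEq m]
    [Fintype k] [DecidableEq k] (W : Matrix m k R) (B : Matrix k m R) (g : R)
    (h : ∀ r : m → k, g ∣ (B.submatrix r id).det) : g ∣ (W * B).det := by
  have h1 : (W * B).det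
      = Matrix.detRowAlternating.toMultilinearMap (fun i => ∑ l, W i l • B l) := by
    refine congrArg Matrix.det ?_
    ext i j
    simp [Matrix.mul_apply]
  rw [h1, MultilinearMap.map_sum]
  refine Finset.dvd_sum fun r _ => ?_
  rw [MultilinearMap.map_smul_univ]
  exact (h r).mul_left _

/-- The hypotheses say exactly that a block matrix of determinant `N.det` factors through `diag(1,
D)`. -/
theorem det_dvd_det_of_relations {S U : Type*} [Fintype S] [DecidableEq S] [Fintype U]
    [DecidableEq U] (N : Matrix S S R) (D : Matrix U U R) (E : Matrix S U R) (F : Matrix U S R)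
    (Y : Matrix S U R) (Z : Matrix U U R) (h1 : N * E = Y * D) (h2 : 1 - F * E = Z * D) :
    D.det ∣ N.det := by
  have h : Matrix.fromBlocks N 0 (-F) 1 * Matrix.fromBlocks 1 E 0 1
      = Matrix.fromBlocks N Y (-F) Z * Matrix.fromBlocks 1 0 0 D := by
    simp only [Matrix.fromBlocks_multiply, ← h1, ← h2]
    congr 1 <;> simp [sub_eq_neg_add]
  have := congrArg Matrix.det h
  rw [Matrix.det_mul, Matrix.det_mul, Matrix.det_fromBlocks_zero₁₂, Matrix.det_fromBlocks_zero₂₁,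
    Matrix.det_fromBlocks_zero₂₁] at this
  simp only [Matrix.det_one, mul_one, one_mul] at this
  exact ⟨_, this.trans (mul_comm _ _)⟩

/-- If the selection `r` misses a row of the identity block, a column vanishes. Otherwise a
permutation moves that block into place, and each remaining row either repeats one of its rows or
comes from `A`. -/
theorem dvd_det_submatrix_fromBlocks_one {S U C : Type*} [Fintype S] [DecidableEq S] [Fintype U]
    [DecidableEq U] (A : Matrix C S R) (g : R)
    (h : ∀ r : S → C, g ∣ (A.submatrix r id).det) (r : U ⊕ S → U ⊕ C) :
    g ∣ ((Matrix.fromBlocks (1 : Matrix U U R) 0 0 A).submatrix r id).det := by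
  classical
  by_cases hr : ∀ u, ∃ x, r x = Sum.inl u
  · choose p hp using hr
    have hpi : Function.Injective p := fun u v e => by
      have := hp u; rw [e, hp v] at this; exact (Sum.inl_injective this).symm
    let e : {x : U ⊕ S // x ∈ Set.range (Sum.inl : U → U ⊕ S)} ≃ {x // x ∈ Set.range p} :=
      (Equiv.ofInjective _ Sum.inl_injective).symm.trans (Equiv.ofInjective p hpi)
    let σ : Equiv.Perm (U ⊕ S) := e.extendSubtype
    have hσ : ∀ u, σ (Sum.inl u) = p u := fun u => by
      have h1 := Equiv.extendSubtype_apply_of_mem e (Sum.inl u) ⟨u, rfl⟩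
      refine h1.trans ?_
      have : (Equiv.ofInjective (Sum.inl : U → U ⊕ S) Sum.inl_injective).symm ⟨Sum.inl u, u, rfl⟩
        = u := (Equiv.symm_apply_eq _).2 rfl
      simp [e, this]
    have hdet := Matrix.det_permute σ
      ((Matrix.fromBlocks (1 : Matrix U U R) 0 0 A).submatrix r id)
    have key : g ∣ (((Matrix.fromBlocks (1 : Matrix U U R) 0 0 A).submatrix r id).submatrix σ
        id).det := by
      rw [Matrix.submatrix_submatrix]
      by_cases hs : ∃ s u, r (σ (Sum.inr s)) = Sum.inl u
      · obtain ⟨s, u, hs⟩ := hs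
        rw [Matrix.det_zero_of_row_eq (i := Sum.inr s) (j := Sum.inl u) (by simp)]
        · exact dvd_zero _
        · ext x
          simp [Matrix.submatrix_apply, hs, hσ, hp]
      · have hs' : ∀ s, ∃ c, r (σ (Sum.inr s)) = Sum.inr c := fun s => by
          rcases hrs : r (σ (Sum.inr s)) with u | c
          · exact absurd ⟨s, u, hrs⟩ hs
          · exact ⟨c, rfl⟩
        choose r' hr' using hs'
        have : (Matrix.fromBlocks (1 : Matrix U U R) 0 0 A).submatrix (r ∘ σ) (id ∘ id)
            = Matrix.fromBlocks 1 0 0 (A.submatrix r' id) := by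
          ext x y
          rcases x with x | x <;> rcases y with y | y <;>
            simp [Matrix.submatrix_apply, hσ, hp, hr']
        rw [this, Matrix.det_fromBlocks_zero₂₁, Matrix.det_one, one_mul]
        exact h r'
    rw [hdet] at key
    rcases Int.units_eq_one_or (Equiv.Perm.sign σ) with h1 | h1 <;> simpa [h1] using key
  · push Not at hr
    obtain ⟨u, hu⟩ := hr
    rw [Matrix.det_eq_zero_of_column_eq_zero (Sum.inl u)]
    · exact dvd_zero _
    · intro x
      rcases hx : r x with v | c
      · have : v ≠ u := fun e => hu x (by rw [hx, e])
        simp [Matrix.submatrix_apply, hx, this]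
      · simp [Matrix.submatrix_apply, hx]

/-- Here `A` need not be square, so the factorization through `diag(1, A)` has rectangular factors
and Cauchy–Binet replaces multiplicativity of the determinant. -/
theorem dvd_det_of_relations {S U C : Type*} [Fintype S] [DecidableEq S] [Fintype U]
    [DecidableEq U] [Fintype C] [DecidableEq C] (A : Matrix C S R) (D : Matrix U U R)
    (E : Matrix S U R)
    (F : Matrix U S R) (Y : Matrix U C R) (Z : Matrix S C R) (h1 : D * F = Y * A)
    (h2 : 1 - E * F = Z * A) (g : R) (hg : ∀ r : S → C, g ∣ (A.submatrix r id).det) :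
    g ∣ D.det := by
  have h : Matrix.fromBlocks D 0 (-E) 1 * Matrix.fromBlocks 1 F 0 1
      = (Matrix.fromBlocks D Y (-E) Z : Matrix (U ⊕ S) (U ⊕ C) R)
        * (Matrix.fromBlocks 1 0 0 A : Matrix (U ⊕ C) (U ⊕ S) R) := by
    rw [Matrix.fromBlocks_multiply, Matrix.fromBlocks_multiply]
    simp [← h1, ← h2, sub_eq_neg_add]
  have := congrArg Matrix.det h
  rw [Matrix.det_mul, Matrix.det_fromBlocks_zero₁₂, Matrix.det_fromBlocks_zero₂₁] at this
  simp only [Matrix.det_one, mul_one] at this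
  rw [this]
  exact dvd_det_mul_of_forall_dvd_det_submatrix _ _ _
    (dvd_det_submatrix_fromBlocks_one A g hg)

/-- The module presented by the rows of a matrix. -/
abbrev RowCokernel {C S : Type*} (A : Matrix C S R) : Type _ :=
  (S → R) ⧸ Submodule.span R (Set.range A.row)

theorem mem_span_range_iff_exists_vecMul {C S : Type*} [Fintype C] (A : Matrix C S R) (v : S → R) :
    v ∈ Submodule.span R (Set.range A.row) ↔ ∃ y : C → R, Matrix.vecMul y A = v := by
  rw [Submodule.mem_span_range_iff_exists_fun]
  refine exists_congr fun y => ?_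
  rw [Matrix.vecMul_eq_sum]
  rfl

theorem exists_mul_eq {C S I : Type*} [Fintype C] (A : Matrix C S R) (V : Matrix I S R)
    (h : ∀ i, V.row i ∈ Submodule.span R (Set.range A.row)) : ∃ Y : Matrix I C R, V = Y * A := by
  choose y hy using fun i => (mem_span_range_iff_exists_vecMul A (V i)).1 (h i)
  exact ⟨y, by ext i j; rw [← hy i]; rfl⟩

theorem mk_vecMul_of_eq {S U : Type*} [Fintype S] [DecidableEq S] {N : Submodule R (U → R)}
    (φ : (S → R) →ₗ[R] (U → R) ⧸ N) (E : S → U → R)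
    (hE : ∀ s, (Submodule.Quotient.mk (E s) : (U → R) ⧸ N) = φ (Pi.single s 1)) (v : S → R) :
    (Submodule.Quotient.mk (Matrix.vecMul v (Matrix.of E)) : (U → R) ⧸ N) = φ v := by
  conv_rhs => rw [pi_eq_sum_univ' v]
  rw [Matrix.vecMul_eq_sum, map_sum, ← Submodule.mkQ_apply, map_sum]
  refine Finset.sum_congr rfl fun s _ => ?_
  rw [map_smul, map_smul, ← hE]
  rfl

/-- The determinant of a square presentation matrix of a module is the greatest common divisor
of the minors of full size of any other presentation matrix. -/
theorem det_isGCD_minors {S U C : Type*} [Fintype S] [DecidableEq S] [Fintype U]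
    [DecidableEq U] [Fintype C] [DecidableEq C] (A : Matrix C S R) (D : Matrix U U R)
    (φ : (S → R) →ₗ[R] RowCokernel D) (ψ : (U → R) →ₗ[R] RowCokernel A)
    (e : RowCokernel A →ₗ[R] RowCokernel D) (e' : RowCokernel D →ₗ[R] RowCokernel A)
    (hφ : ∀ v, e (Submodule.Quotient.mk v) = φ v) (hψ : ∀ v, e' (Submodule.Quotient.mk v) = ψ v)
    (h : ∀ s, e' (φ (Pi.single s 1)) = Submodule.Quotient.mk (Pi.single s 1))
    (h' : ∀ u, e (ψ (Pi.single u 1)) = Submodule.Quotient.mk (Pi.single u 1)) :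
    (∀ r : S → C, D.det ∣ (A.submatrix r id).det) ∧
      ∀ g, (∀ r : S → C, g ∣ (A.submatrix r id).det) → g ∣ D.det := by
  have hE : ∀ s, ∃ v : U → R, (Submodule.Quotient.mk v : RowCokernel D) = φ (Pi.single s 1) :=
    fun s => Submodule.Quotient.mk_surjective _ _
  have hF : ∀ u, ∃ v : S → R, (Submodule.Quotient.mk v : RowCokernel A) = ψ (Pi.single u 1) :=
    fun u => Submodule.Quotient.mk_surjective _ _
  choose E hE using hE
  choose F hF using hF
  have hE' : ∀ v : S → R, (Submodule.Quotient.mk (Matrix.vecMul v (Matrix.of E)) : RowCokernel D)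
      = φ v := mk_vecMul_of_eq φ E hE
  have hF' : ∀ v : U → R, (Submodule.Quotient.mk (Matrix.vecMul v (Matrix.of F)) : RowCokernel A)
      = ψ v := mk_vecMul_of_eq ψ F hF
  have hA : ∀ c, (Submodule.Quotient.mk (A.row c) : RowCokernel A) = 0 := fun c =>
    (Submodule.Quotient.mk_eq_zero _).2 (Submodule.subset_span ⟨c, rfl⟩)
  have hD : ∀ u, (Submodule.Quotient.mk (D.row u) : RowCokernel D) = 0 := fun u =>
    (Submodule.Quotient.mk_eq_zero _).2 (Submodule.subset_span ⟨u, rfl⟩)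
  -- `E` and `F` lift the two maps to the free modules. Since these are mutually inverse on the
  -- cokernels, `F * E` and `E * F` are the identity modulo the rows of `D` and of `A`.
  obtain ⟨Z₁, hZ₁⟩ := exists_mul_eq D (1 - Matrix.of F * Matrix.of E) fun u => by
    have h1 : (1 - Matrix.of F * Matrix.of E).row u
        = Pi.single u 1 - Matrix.vecMul (F u) (Matrix.of E) := by
      ext v; simp [Matrix.one_apply, Pi.single_apply, eq_comm, Matrix.mul_apply, Matrix.vecMul,
        dotProduct]
    rw [← Submodule.Quotient.mk_eq_zero, h1, Submodule.Quotient.mk_sub, hE', ← hφ, hF, h', sub_self]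
  obtain ⟨Z₂, hZ₂⟩ := exists_mul_eq A (1 - Matrix.of E * Matrix.of F) fun s => by
    have h1 : (1 - Matrix.of E * Matrix.of F).row s
        = Pi.single s 1 - Matrix.vecMul (E s) (Matrix.of F) := by
      ext v; simp [Matrix.one_apply, Pi.single_apply, eq_comm, Matrix.mul_apply, Matrix.vecMul,
        dotProduct]
    rw [← Submodule.Quotient.mk_eq_zero, h1, Submodule.Quotient.mk_sub, hF', ← hψ, hE, h, sub_self]
  refine ⟨fun r => ?_, ?_⟩
  · obtain ⟨Y, hY⟩ := exists_mul_eq D (A.submatrix r id * Matrix.of E) fun s => by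
      rw [← Submodule.Quotient.mk_eq_zero]
      change Submodule.Quotient.mk (Matrix.vecMul (A.row (r s)) (Matrix.of E)) = _
      rw [hE', ← hφ, hA, map_zero]
    exact det_dvd_det_of_relations _ D _ _ Y Z₁ hY hZ₁
  · obtain ⟨Y, hY⟩ := exists_mul_eq A (D * Matrix.of F) fun u => by
      rw [← Submodule.Quotient.mk_eq_zero]
      change Submodule.Quotient.mk (Matrix.vecMul (D.row u) (Matrix.of F)) = _
      rw [hF', ← hψ, hD, map_zero]
    exact dvd_det_of_relations A D _ _ Y Z₂ hY hZ₂

end Fitting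

/-- After clearing denominators, a unit and its inverse become polynomials whose product is a power
of the prime `X`. -/
theorem LaurentPolynomial.exists_eq_T_or_eq_neg_T_of_isUnit {u : ℤ[T;T⁻¹]} (hu : IsUnit u) :
    ∃ k : ℤ, u = LaurentPolynomial.T k ∨ u = -LaurentPolynomial.T k := by
  obtain ⟨v, hv⟩ := hu.exists_right_inv
  obtain ⟨a, f, hf⟩ := LaurentPolynomial.exists_T_pow u
  obtain ⟨b, g, hg⟩ := LaurentPolynomial.exists_T_pow v
  have hfg : f * g = Polynomial.X ^ (a + b) := by
    apply Polynomial.toLaurent_injective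
    rw [map_mul, hf, hg, Polynomial.toLaurent_X_pow, Nat.cast_add, LaurentPolynomial.T_add]
    calc _ = (u * v) * (LaurentPolynomial.T a * LaurentPolynomial.T b) := by ring
      _ = _ := by rw [hv, one_mul]
  obtain ⟨i, -, c, hc⟩ := (dvd_prime_pow Polynomial.prime_X _).1 (Dvd.intro _ hfg)
  obtain ⟨r, hr, hr'⟩ := Polynomial.isUnit_iff.1 c⁻¹.isUnit
  have hf2 : f = Polynomial.C r * Polynomial.X ^ i := by
    rw [hr', ← hc, mul_comm f, Units.inv_mul_cancel_left]
  have hu2 : u = Polynomial.toLaurent f * LaurentPolynomial.T (-a) := by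
    rw [hf, LaurentPolynomial.mul_T_assoc]; simp
  refine ⟨i - a, ?_⟩
  rw [hu2, hf2, Polynomial.toLaurent_C_mul_X_pow, LaurentPolynomial.mul_T_assoc, ← sub_eq_add_neg]
  rcases Int.isUnit_iff.1 hr with rfl | rfl
  · left; simp
  · right; simp

/-! ### Determinants of chains of two-term relations. -/

section Chain

variable {R : Type*} [CommRing R]

/-- The matrix of the relations `∑ dᵢ = 0` and `βᵢ dᵢ = αᵢ₊₁ dᵢ₊₁`. -/
def chainMatrix {m : ℕ} (α β : Fin (m + 1) → R) : Matrix (Fin (m + 1)) (Fin (m + 1)) R :=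
  Matrix.of (Fin.cons (fun _ => 1) fun k : Fin m =>
    Pi.single k.castSucc (β k.castSucc) - Pi.single k.succ (α k.succ))

/-- The sum of the products `β₀ ⋯ βᵢ₋₁ αᵢ₊₁ ⋯ αₘ`. -/
def chainSum {m : ℕ} (α β : Fin (m + 1) → R) : R :=
  ∑ i, ∏ j, if j < i then β j else if i < j then α j else 1

theorem chainSum_zero (α β : Fin 1 → R) : chainSum α β = 1 := by
  simp [chainSum]

theorem chainSum_succ {m : ℕ} (α β : Fin (m + 2) → R) :
    chainSum α β = ∏ k : Fin (m + 1), α k.succ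
      + β 0 * chainSum (fun k => α k.succ) (fun k => β k.succ) := by
  rw [chainSum, Fin.sum_univ_succ, chainSum, Finset.mul_sum]
  simp [Fin.prod_univ_succ]

/-- In the first column only the rows `0` and `1` are nonzero. Deleting row `0` leaves a triangular
matrix, deleting row `1` leaves the shorter chain; this is the recursion `chainSum_succ`. -/
theorem det_chainMatrix {m : ℕ} (α β : Fin (m + 1) → R) :
    (chainMatrix α β).det = (-1) ^ m * chainSum α β := by
  induction m with
  | zero => simp [chainMatrix, chainSum_zero]
  | succ m ih =>
    rw [Matrix.det_succ_column_zero, Fin.sum_univ_succ, Fin.sum_univ_succ,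
      Finset.sum_eq_zero (s := Finset.univ (α := Fin m))]
    · have h0 : ((chainMatrix α β).submatrix (Fin.succAbove 0) Fin.succ).det
          = ∏ k : Fin (m + 1), -α k.succ := by
        rw [Matrix.det_of_isLowerTriangular]
        · refine Finset.prod_congr rfl fun k _ => ?_
          have : k.succ ≠ k.castSucc := Fin.castSucc_lt_succ.ne'
          simp [chainMatrix, this]
        · intro i j hij
          have hij : i < j := hij
          have h1 : j.succ ≠ i.castSucc := by
            intro h; have := congrArg Fin.val h; simp at this; omega
          simp [chainMatrix, h1, hij.ne']
      have h1 : (chainMatrix α β).submatrix (Fin.succAbove (Fin.succ 0)) Fin.succ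
          = chainMatrix (fun k => α k.succ) (fun k => β k.succ) := by
        ext i j
        refine Fin.cases ?_ (fun i => ?_) i
        · simp [chainMatrix]
        · simp only [Matrix.submatrix_apply, Fin.succ_succAbove_succ, Fin.succAbove_zero,
            chainMatrix, Matrix.of_apply, Fin.cons_succ, Pi.sub_apply, Pi.single_apply,
            Fin.castSucc_succ, Fin.succ_inj]
      rw [h0, h1, ih, chainSum_succ]
      simp only [Finset.prod_neg, Finset.card_univ, Fintype.card_fin]
      simp [chainMatrix]
      ring
    · intro i _
      have h1 : (0 : Fin (m + 2)) ≠ i.succ.castSucc := by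
        rw [Fin.castSucc_succ]; exact (Fin.succ_ne_zero _).symm
      have : chainMatrix α β i.succ.succ 0 = 0 := by
        simp [chainMatrix, h1, -Fin.castSucc_succ]
      rw [this]; ring

/-- Replacing the `α i` by the `β i` one at a time telescopes, as in the factorization of `x ^ n - y
^ n`. -/
theorem mul_chainSum_of_sub_eq {m : ℕ} (α β : Fin (m + 1) → R) (κ : R)
    (h : ∀ i, β i - α i = κ) : κ * chainSum α β = ∏ i, β i - ∏ i, α i := by
  induction m with
  | zero => simp [chainSum_zero, ← h 0]
  | succ m ih =>
    have := ih (fun k => α k.succ) (fun k => β k.succ) fun i => h _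
    rw [chainSum_succ, Fin.prod_univ_succ β, Fin.prod_univ_succ α, mul_add, mul_left_comm, this,
      ← h 0]
    ring

theorem map_chainSum {S : Type*} [CommRing S] (f : R →+* S) {m : ℕ} (α β : Fin (m + 1) → R) :
    f (chainSum α β) = chainSum (fun i => f (α i)) (fun i => f (β i)) := by
  simp only [chainSum, map_sum, map_prod]
  refine Finset.sum_congr rfl fun i _ => Finset.prod_congr rfl fun j _ => ?_
  split_ifs <;> simp

/-- The ratios `β i / α i = v i / w i` telescope, so the `i`-th summand is `v 0 * (∏ j, α j) / (v i
* α i)`. -/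
theorem chainSum_of_weights {K : Type*} [Field K] {m : ℕ} (α β v w : Fin (m + 1) → K)
    (hα : ∀ i, α i ≠ 0) (hv : ∀ i, v i ≠ 0) (h : ∀ i, w i * β i = v i * α i)
    (hvw : ∀ k : Fin m, v k.succ = w k.castSucc) :
    chainSum α β = v 0 * (∏ i, α i) * ∑ i, (v i * α i)⁻¹ := by
  induction m with
  | zero =>
    have := hα 0; have := hv 0
    simp [chainSum_zero]; field_simp
  | succ m ih =>
    have h1 := ih (fun k => α k.succ) (fun k => β k.succ) (fun k => v k.succ) (fun k => w k.succ)
      (fun _ => hα _) (fun _ => hv _) (fun _ => h _) (fun k => by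
        have := hvw k.succ; rwa [Fin.castSucc_succ] at this)
    have h0 : v (Fin.succ 0) * β 0 = v 0 * α 0 := by rw [← h 0, hvw 0]; rfl
    rw [chainSum_succ, h1, Fin.prod_univ_succ α,
      Fin.sum_univ_succ fun i => (v i * α i)⁻¹]
    have hα0 := hα 0; have hv0 := hv 0
    calc _ = (∏ k : Fin (m + 1), α k.succ) + (v (Fin.succ 0) * β 0) * (∏ k : Fin (m + 1), α k.succ)
          * ∑ i : Fin (m + 1), (v i.succ * α i.succ)⁻¹ := by ring
      _ = _ := by rw [h0]; field_simp

end Chain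

theorem tVar_ne_zero : tVar ≠ 0 := by
  rw [tVar, Ne, FaithfulSMul.algebraMap_eq_zero_iff]
  exact (LaurentPolynomial.isUnit_T 1).ne_zero

theorem algebraMap_T (k : ℤ) :
    algebraMap ℤ[T;T⁻¹] LaurentFrac (LaurentPolynomial.T k) = tVar ^ k := by
  have hnat : ∀ k : ℕ, algebraMap ℤ[T;T⁻¹] LaurentFrac (LaurentPolynomial.T k) = tVar ^ k :=
    fun k => by rw [tVar, ← map_pow, LaurentPolynomial.T_pow, mul_one]
  obtain ⟨k, rfl | rfl⟩ := k.eq_nat_or_neg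
  · rw [hnat, zpow_natCast]
  · rw [zpow_neg, zpow_natCast, ← hnat]
    refine eq_inv_of_mul_eq_one_left ?_
    rw [← map_mul, ← LaurentPolynomial.T_add, neg_add_cancel, LaurentPolynomial.T_zero, map_one]

/-! ### Colorings and the module of the Alexander matrix. -/

namespace LinkDiagram

variable (D : LinkDiagram) (o : D.Orientation)

/-- Labels of the half-edges in a module that respect the arcs and satisfy the relation of the
Alexander matrix at each crossing. -/
structure IsColoring {M : Type*} [AddCommGroup M] [Module ℤ[T;T⁻¹] M] (f : D.HalfEdge → M) :
    Prop where
  glue : ∀ h, f (D.glue h) = f h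
  overpass : ∀ c, f (c, D.overCorner c + 2) = f (c, D.overCorner c)
  relation : ∀ c, (1 - LaurentPolynomial.T 1 : ℤ[T;T⁻¹]) • f (c, D.overOut o c)
    + (LaurentPolynomial.T 1 : ℤ[T;T⁻¹]) • f (c, D.overOut o c + 1)
    - f (c, D.overOut o c + 3) = 0

variable {D o}

theorem IsColoring.map {M N : Type*} [AddCommGroup M] [Module ℤ[T;T⁻¹] M] [AddCommGroup N]
    [Module ℤ[T;T⁻¹] N] {f : D.HalfEdge → M} (hf : D.IsColoring o f) (φ : M →ₗ[ℤ[T;T⁻¹]] N) :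
    D.IsColoring o fun h => φ (f h) where
  glue h := by rw [hf.glue]
  overpass c := by rw [hf.overpass]
  relation c := by
    have := congrArg φ (hf.relation c)
    simp only [map_sub, map_add, map_smul, map_zero] at this
    exact this

theorem IsColoring.exists_lift {M : Type*} [AddCommGroup M] [Module ℤ[T;T⁻¹] M]
    {f : D.HalfEdge → M} (hf : D.IsColoring o f) : ∃ g : D.Arc → M, ∀ h, g (D.arc h) = f h := by
  refine ⟨Quot.lift f ?_, fun h => rfl⟩
  intro _ _ hr
  cases hr with
  | edge => exact (hf.glue _).symm
  | overpass c => exact (hf.overpass c).symm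

theorem sum_alexanderMatrix_smul {M : Type*} [AddCommGroup M] [Module ℤ[T;T⁻¹] M]
    (g : D.Arc → M) (c : D.Crossing) :
    ∑ s, D.alexanderMatrix o c s • g s =
      (1 - LaurentPolynomial.T 1 : ℤ[T;T⁻¹]) • g (D.arc (c, D.overOut o c))
    + (LaurentPolynomial.T 1 : ℤ[T;T⁻¹]) • g (D.arc (c, D.overOut o c + 1))
    - g (D.arc (c, D.overOut o c + 3)) := by
  simp only [alexanderMatrix, Pi.sub_apply, Pi.add_apply, sub_smul, add_smul,
    Finset.sum_sub_distrib, Finset.sum_add_distrib, Pi.single_apply, ite_smul, zero_smul,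
    Finset.sum_ite_eq', Finset.mem_univ, if_true, one_smul]

theorem isColoring_of_arc {M : Type*} [AddCommGroup M] [Module ℤ[T;T⁻¹] M] (g : D.Arc → M)
    (hg : ∀ c, ∑ s, D.alexanderMatrix o c s • g s = 0) :
    D.IsColoring o fun h => g (D.arc h) where
  glue h := congrArg g (Quot.sound (ArcRel.edge h)).symm
  overpass c := congrArg g (Quot.sound (ArcRel.overpass c)).symm
  relation c := by rw [← sum_alexanderMatrix_smul, hg]

/-- A universal coloring with values in a module with a square presentation matrix computes the
Alexander polynomial. -/
theorem det_isAlexanderPolynomial [Nonempty D.Crossing] {U : Type} [Fintype U] [DecidableEq U]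
    (P : Matrix U U ℤ[T;T⁻¹]) (c : D.HalfEdge → RowCokernel P) (hc : D.IsColoring o c)
    (p p' : U → D.HalfEdge)
    (hp : ∀ u, c (p u) - c (p' u) = Submodule.Quotient.mk (Pi.single u 1))
    (hrel : ∀ (M : Type) [AddCommGroup M] [Module ℤ[T;T⁻¹] M] (f : D.HalfEdge → M),
      D.IsColoring o f → ∀ u, ∑ v, P u v • (f (p v) - f (p' v)) = 0)
    (hrigid : ∀ (M : Type) [AddCommGroup M] [Module ℤ[T;T⁻¹] M] (f g : D.HalfEdge → M),
      D.IsColoring o f → D.IsColoring o g → (∀ u, f (p u) - f (p' u) = g (p u) - g (p' u)) →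
      ∀ x y, f x - f y = g x - g y) :
    D.IsAlexanderPolynomial o P.det := by
  classical
  have := Fintype.ofFinite D.Crossing
  have key : ∀ j : D.Arc, (∀ r, P.det ∣ D.alexanderMinor o j r) ∧
      ∀ g, (∀ r, g ∣ D.alexanderMinor o j r) → g ∣ P.det := by
    intro j
    let A : Matrix D.Crossing {s : D.Arc // s ≠ j} ℤ[T;T⁻¹] :=
      (D.alexanderMatrix o).submatrix id Subtype.val
    obtain ⟨y, rfl⟩ : ∃ y, D.arc y = j := Quot.mk_surjective j
    obtain ⟨g, hg⟩ := hc.exists_lift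
    -- The entries of a row add up to `0`, so a coloring may be shifted to vanish on the deleted
    -- arc.
    have hgrel : ∀ c, ∑ s, D.alexanderMatrix o c s • (g s - g (D.arc y)) = 0 := fun c => by
      rw [sum_alexanderMatrix_smul]
      have := hc.relation c
      simp only [← hg] at this
      rw [← this]; module
    -- The universal coloring that vanishes on the deleted arc.
    let x : D.Arc → RowCokernel A := fun s =>
      if h : s = D.arc y then 0 else Submodule.Quotient.mk (Pi.single ⟨s, h⟩ 1)
    have hxj : x (D.arc y) = 0 := dif_pos rfl
    have hxs : ∀ s : {s : D.Arc // s ≠ D.arc y}, x s = Submodule.Quotient.mk (Pi.single s 1) :=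
      fun s => dif_neg s.2
    have hsum : ∀ {M : Type} [AddCommGroup M] [Module ℤ[T;T⁻¹] M] (z : D.Arc → M) (c : D.Crossing),
        z (D.arc y) = 0 → ∑ s : {s : D.Arc // s ≠ D.arc y}, A c s • z s
          = ∑ s, D.alexanderMatrix o c s • z s := fun z c hz => by
      rw [Fintype.sum_eq_add_sum_subtype_ne _ (D.arc y), hz, smul_zero, zero_add]
      rfl
    have hxcol : D.IsColoring o fun h => x (D.arc h) := isColoring_of_arc x fun c => by
      rw [← hsum x c hxj]
      have h1 : (Submodule.Quotient.mk (A.row c) : RowCokernel A) = 0 :=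
        (Submodule.Quotient.mk_eq_zero _).2 (Submodule.subset_span ⟨c, rfl⟩)
      rw [← h1, pi_eq_sum_univ' (A.row c), ← Submodule.mkQ_apply, map_sum]
      refine Finset.sum_congr rfl fun s _ => ?_
      rw [map_smul, hxs]
      rfl
    let φ := Fintype.linearCombination ℤ[T;T⁻¹]
      fun s : {s : D.Arc // s ≠ D.arc y} => g s - g (D.arc y)
    let ψ := Fintype.linearCombination ℤ[T;T⁻¹] fun u : U => x (D.arc (p u)) - x (D.arc (p' u))
    have hφ : Submodule.span ℤ[T;T⁻¹] (Set.range A.row) ≤ LinearMap.ker φ := by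
      rw [Submodule.span_le]
      rintro _ ⟨c, rfl⟩
      change φ _ = 0
      rw [Fintype.linearCombination_apply]
      exact (hsum (fun s => g s - g (D.arc y)) c (sub_self _)).trans (hgrel c)
    have hψ : Submodule.span ℤ[T;T⁻¹] (Set.range P.row) ≤ LinearMap.ker ψ := by
      rw [Submodule.span_le]
      rintro _ ⟨u, rfl⟩
      change ψ _ = 0
      rw [Fintype.linearCombination_apply]
      exact hrel _ _ hxcol u
    have hψp : ∀ u, Submodule.liftQ _ ψ hψ (c (p u) - c (p' u))
        = x (D.arc (p u)) - x (D.arc (p' u)) := fun u => by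
      rw [hp]
      exact (Fintype.linearCombination_apply_single _ _ _ _).trans (one_smul _ _)
    have hφx : ∀ s, Submodule.liftQ _ φ hφ (x s) = g s - g (D.arc y) := fun s => by
      by_cases h : s = D.arc y
      · rw [h, hxj, map_zero, sub_self]
      · rw [show x s = _ from hxs ⟨s, h⟩]
        exact (Fintype.linearCombination_apply_single _ _ _ _).trans (one_smul _ _)
    refine det_isGCD_minors A P φ ψ (Submodule.liftQ _ φ hφ) (Submodule.liftQ _ ψ hψ)
      (fun v => rfl) (fun v => rfl) ?_ ?_
    · intro s
      obtain ⟨h, hh⟩ : ∃ h, D.arc h = s.1 := Quot.mk_surjective s.1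
      have h1 : φ (Pi.single s 1) = c h - c y := by
        rw [Fintype.linearCombination_apply_single, one_smul, ← hg, ← hg, ← hh]
      -- The image of `c` and the coloring `x` have the same differences at all pairs `p u`, `p' u`,
      -- hence everywhere; so the two maps are inverse on generators.
      have h2 := hrigid _ _ _ (hc.map (Submodule.liftQ _ ψ hψ)) hxcol (fun u => by
        rw [← map_sub, hψp]) h y
      rw [h1, ← hxs, ← hh, map_sub]
      exact h2.trans (by rw [hxj, sub_zero])
    · intro u
      rw [Fintype.linearCombination_apply_single, one_smul, map_sub, hφx, hφx,
        sub_sub_sub_cancel_right, hg, hg, hp]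
  obtain ⟨c₀⟩ := ‹Nonempty D.Crossing›
  exact ⟨fun j r => (key j).1 r, fun g hg => (key (D.arc (c₀, 0))).2 g (hg _)⟩

theorem dotEq_alexanderPolynomial {Δ : ℤ[T;T⁻¹]} (h : D.IsAlexanderPolynomial o Δ) :
    DotEq (algebraMap ℤ[T;T⁻¹] LaurentFrac (D.alexanderPolynomial o))
      (algebraMap ℤ[T;T⁻¹] LaurentFrac Δ) := by
  have h' := D.alexanderPolynomial_spec o
  obtain ⟨u, hu⟩ := associated_of_dvd_dvd (h'.2 _ h.1) (h.2 _ h'.1)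
  have hT : ∀ k : ℤ, algebraMap ℤ[T;T⁻¹] LaurentFrac (LaurentPolynomial.T k) = tVar ^ k :=
    algebraMap_T
  obtain ⟨k, hk⟩ := LaurentPolynomial.exists_eq_T_or_eq_neg_T_of_isUnit u.isUnit
  refine ⟨k, ?_⟩
  rw [← hu]
  rcases hk with hk | hk
  · left
    rw [hk, map_mul, hT, mul_comm]
  · right
    rw [hk, map_mul, map_neg, hT, mul_neg, mul_comm]

end LinkDiagram

namespace LinkDiagram

variable (D : LinkDiagram) (o : D.Orientation)

/-- The factor by which the difference with the overstrand is multiplied when the understrand is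
followed through `c` against the counterclockwise numbering of the half-edges. -/
noncomputable def crossingWeight (c : D.Crossing) : ℤ[T;T⁻¹] :=
  if o.outgoing (c, D.overCorner c) then LaurentPolynomial.T (-1) else LaurentPolynomial.T 1

variable {D o}

/-- Reversing the overstrand exchanges its left and right sides, which inverts the factor `t`; thus
only the weight depends on the orientation. -/
theorem relation_iff_crossingWeight {M : Type*} [AddCommGroup M] [Module ℤ[T;T⁻¹] M]
    (f : D.HalfEdge → M) (c : D.Crossing)
    (h : f (c, D.overCorner c + 2) = f (c, D.overCorner c)) :
    (1 - LaurentPolynomial.T 1 : ℤ[T;T⁻¹]) • f (c, D.overOut o c)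
      + (LaurentPolynomial.T 1 : ℤ[T;T⁻¹]) • f (c, D.overOut o c + 1)
      - f (c, D.overOut o c + 3) = 0 ↔
    f (c, D.overCorner c + 1) - f (c, D.overCorner c)
      = D.crossingWeight o c • (f (c, D.overCorner c + 3) - f (c, D.overCorner c)) := by
  have h1 : (LaurentPolynomial.T 1 * LaurentPolynomial.T (-1) : ℤ[T;T⁻¹]) = 1 := by
    rw [← LaurentPolynomial.T_add, add_neg_cancel, LaurentPolynomial.T_zero]
  unfold overOut crossingWeight
  split_ifs with ho
  · constructor
    · intro H
      have H' : (LaurentPolynomial.T 1 : ℤ[T;T⁻¹]) • (f (c, D.overCorner c + 1)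
          - f (c, D.overCorner c)) = f (c, D.overCorner c + 3) - f (c, D.overCorner c) := by
        rw [← sub_eq_zero, ← H]; module
      rw [← H', smul_smul, mul_comm, h1, one_smul]
    · intro H
      have H' : (LaurentPolynomial.T 1 : ℤ[T;T⁻¹]) • (f (c, D.overCorner c + 1)
          - f (c, D.overCorner c)) = f (c, D.overCorner c + 3) - f (c, D.overCorner c) := by
        rw [H, smul_smul, h1, one_smul]
      rw [← sub_eq_zero] at H'
      rw [← H']; module
  · have e1 : D.overCorner c + 2 + 1 = D.overCorner c + 3 := by rw [add_assoc]; rfl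
    have e3 : D.overCorner c + 2 + 3 = D.overCorner c + 1 := by rw [add_assoc]; rfl
    rw [h, e1, e3, ← sub_eq_zero (b := _ • _), ← neg_eq_zero]
    refine Eq.congr ?_ rfl
    module

end LinkDiagram

/-! ### Sums along a twist region. -/

section ColumnSums

variable {R : Type*} [CommRing R]

/-- The factor by which the difference of the labels of the two strands of a twist region is
multiplied along its first `k` crossings. -/
def columnFactor (τ : ℕ → R) (k : ℕ) : R := ∏ j ∈ Finset.range k, -τ j

/-- The sum of the first `k` column factors. -/
def columnSum (τ : ℕ → R) (k : ℕ) : R := ∑ j ∈ Finset.range k, columnFactor τ j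

/-- The sum of the first `k` column factors with weights. -/
def columnWeightedSum (τ : ℕ → R) (k : ℕ) : R := ∑ j ∈ Finset.range k, τ j * columnFactor τ j

/-- Consecutive factors differ by `-(1 + τ k) * columnFactor τ k`. In a twist region this expresses
the difference of the two strands at depth `k` through their separate displacements. -/
theorem columnFactor_eq (τ : ℕ → R) (k : ℕ) :
    columnFactor τ k = 1 - columnSum τ k - columnWeightedSum τ k := by
  induction k with
  | zero => simp [columnFactor, columnSum, columnWeightedSum]
  | succ k ih =>
    have h1 : columnFactor τ (k + 1) = columnFactor τ k * -τ k := Finset.prod_range_succ _ _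
    have h2 : columnSum τ (k + 1) = columnSum τ k + columnFactor τ k := Finset.sum_range_succ _ _
    have h3 : columnWeightedSum τ (k + 1) = columnWeightedSum τ k + τ k * columnFactor τ k :=
      Finset.sum_range_succ _ _
    rw [h1, h2, h3]
    linear_combination ih

end ColumnSums

/-! ### Propagation of a coloring through the pretzel diagram. -/

namespace Pretzel

open LinkDiagram

variable {n : ℕ} {q : Fin n → ℤ} {hq : ∀ i, q i ≠ 0}
/-- The `k`-th crossing from the top of the `i`-th twist region. -/
def crossing (hq : ∀ i, q i ≠ 0) (i : Fin n) (k : ℕ) (hk : k < (q i).natAbs) :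
    (pretzelDiagram q hq).Crossing := ⟨i, k, hk⟩

theorem exists_crossing (c : (pretzelDiagram q hq).Crossing) :
    ∃ i k, ∃ hk : k < (q i).natAbs, crossing hq i k hk = c :=
  ⟨c.1, c.2.1, c.2.2, rfl⟩

variable (o : (pretzelDiagram q hq).Orientation)

/-- The weight of the `k`-th crossing of the `i`-th twist region. -/
noncomputable def weight (i : Fin n) (k : ℕ) : ℤ[T;T⁻¹] :=
  if h : k < (q i).natAbs then (pretzelDiagram q hq).crossingWeight o (crossing hq i k h) else 1

/-- The label of the left strand below `k` crossings of the `i`-th twist region is the one at the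
top plus this multiple of the difference of the two labels at the top. -/
noncomputable def leftCoeff (i : Fin n) (k : ℕ) : ℤ[T;T⁻¹] :=
  if 0 < q i then -columnSum (weight o i) k else -columnWeightedSum (weight o i) k

/-- The analogue of `leftCoeff` for the right strand. -/
noncomputable def rightCoeff (i : Fin n) (k : ℕ) : ℤ[T;T⁻¹] :=
  if 0 < q i then columnWeightedSum (weight o i) k else columnSum (weight o i) k

@[simp] theorem leftCoeff_zero (i : Fin n) : leftCoeff o i 0 = 0 := by
  simp [leftCoeff, columnSum, columnWeightedSum]

@[simp] theorem rightCoeff_zero (i : Fin n) : rightCoeff o i 0 = 0 := by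
  simp [rightCoeff, columnSum, columnWeightedSum]

variable {o}

/-- The relations at a crossing express the two lower labels by the two upper ones. -/
theorem crossing_iff {M : Type*} [AddCommGroup M] [Module ℤ[T;T⁻¹] M]
    (f : (pretzelDiagram q hq).HalfEdge → M) (i : Fin n) (k : ℕ) (hk : k < (q i).natAbs) (a b d : M)
    (hd : a - b = d)
    (h0 : f (crossing hq i k hk, 0) = a + leftCoeff o i k • d)
    (h3 : f (crossing hq i k hk, 3) = b + rightCoeff o i k • d) :
    (f (crossing hq i k hk, (pretzelDiagram q hq).overCorner (crossing hq i k hk) + 2)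
        = f (crossing hq i k hk, (pretzelDiagram q hq).overCorner (crossing hq i k hk)) ∧
      f (crossing hq i k hk, (pretzelDiagram q hq).overCorner (crossing hq i k hk) + 1)
          - f (crossing hq i k hk, (pretzelDiagram q hq).overCorner (crossing hq i k hk))
        = (pretzelDiagram q hq).crossingWeight o (crossing hq i k hk) •
          (f (crossing hq i k hk, (pretzelDiagram q hq).overCorner (crossing hq i k hk) + 3)
          - f (crossing hq i k hk, (pretzelDiagram q hq).overCorner (crossing hq i k hk)))) ↔
    (f (crossing hq i k hk, 1) = a + leftCoeff o i (k + 1) • d ∧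
      f (crossing hq i k hk, 2) = b + rightCoeff o i (k + 1) • d) := by
  have hw : (pretzelDiagram q hq).crossingWeight o (crossing hq i k hk) = weight o i k :=
    by rw [weight, dif_pos hk]
  have h2 : columnSum (weight o i) (k + 1) = columnSum (weight o i) k
    + columnFactor (weight o i) k := Finset.sum_range_succ _ _
  have h3' : columnWeightedSum (weight o i) (k + 1) = columnWeightedSum (weight o i) k
    + weight o i k * columnFactor (weight o i) k := Finset.sum_range_succ _ _
  obtain rfl : a = b + d := by rw [← hd]; abel
  rw [hw]
  by_cases hpos : 0 < q i
  -- The overstrand runs from south-west to north-east: the lower left label copies the upper right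
  -- one, and the lower right label differs from it by the weight times the upper difference. The
  -- other case is the mirror image.
  · have hoc : (pretzelDiagram q hq).overCorner (crossing hq i k hk) = 1 := if_pos hpos
    simp only [leftCoeff, rightCoeff, if_pos hpos] at h0 h3 ⊢
    rw [hoc, show (1 + 2 : Fin 4) = 3 from rfl, show (1 + 1 : Fin 4) = 2 from rfl,
      show (1 + 3 : Fin 4) = 0 from rfl, h0, h3, h2, h3', columnFactor_eq]
    constructor
    · rintro ⟨e1, e2⟩
      rw [← e1] at e2 ⊢
      rw [sub_eq_iff_eq_add] at e2
      rw [e2]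
      constructor <;> module
    · rintro ⟨e1, e2⟩
      rw [e1, e2]
      constructor <;> module
  · have hoc : (pretzelDiagram q hq).overCorner (crossing hq i k hk) = 0 := if_neg hpos
    simp only [leftCoeff, rightCoeff, if_neg hpos] at h0 h3 ⊢
    rw [hoc, show (0 + 2 : Fin 4) = 2 from rfl, show (0 + 1 : Fin 4) = 1 from rfl,
      show (0 + 3 : Fin 4) = 3 from rfl, h0, h3, h2, h3', columnFactor_eq]
    constructor
    · rintro ⟨e1, e2⟩
      rw [sub_eq_iff_eq_add] at e2
      rw [e1, e2]
      constructor <;> module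
    · rintro ⟨e1, e2⟩
      rw [e1, e2]
      constructor <;> module

/-- The top crossing of a twist region. -/
def top (hq : ∀ i, q i ≠ 0) (i : Fin n) : (pretzelDiagram q hq).Crossing :=
  crossing hq i 0 (Int.natAbs_pos.mpr (hq i))

theorem glue_left {i : Fin n} {k : ℕ} (hk : k + 1 < (q i).natAbs) :
    (pretzelDiagram q hq).glue (crossing hq i k (k.lt_succ_self.trans hk), 1)
      = (crossing hq i (k + 1) hk, 0) := by
  have : pretzelGlue q hq (⟨i, k, k.lt_succ_self.trans hk⟩, 1) = (⟨i, k + 1, hk⟩, 0) := by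
    simp only [pretzelGlue]
    rw [dif_pos hk]
  exact this

theorem glue_right {i : Fin n} {k : ℕ} (hk : k + 1 < (q i).natAbs) :
    (pretzelDiagram q hq).glue (crossing hq i k (k.lt_succ_self.trans hk), 2)
      = (crossing hq i (k + 1) hk, 3) := by
  have : pretzelGlue q hq (⟨i, k, k.lt_succ_self.trans hk⟩, 2) = (⟨i, k + 1, hk⟩, 3) := by
    simp only [pretzelGlue]
    rw [dif_pos hk]
  exact this

theorem glue_top (i : Fin n) :
    (pretzelDiagram q hq).glue (top hq i, 3) = (top hq (finRotate n i), 0) := by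
  have : pretzelGlue q hq (⟨i, 0, Int.natAbs_pos.mpr (hq i)⟩, 3)
      = (⟨finRotate n i, 0, Int.natAbs_pos.mpr (hq _)⟩, 0) := by
    simp only [pretzelGlue]
    rw [if_pos trivial]
  exact this

theorem glue_bottom {i : Fin n} {k l : ℕ} (hk : k + 1 = (q i).natAbs)
    (hl : l + 1 = (q (finRotate n i)).natAbs) :
    (pretzelDiagram q hq).glue (crossing hq i k (by omega), 2)
      = (crossing hq (finRotate n i) l (by omega), 1) := by
  have : pretzelGlue q hq (⟨i, k, by omega⟩, 2) = (⟨finRotate n i, l, by omega⟩, 1) := by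
    obtain rfl : l = (q (finRotate n i)).natAbs - 1 := by omega
    simp only [pretzelGlue]
    rw [dif_neg (by omega)]
  exact this

/-- To check invariance under the gluing, it suffices to consider one end of each edge. -/
theorem glue_invariant {M : Type*} (f : (pretzelDiagram q hq).HalfEdge → M)
    (h1 : ∀ i k (hk : k + 1 < (q i).natAbs),
      f (crossing hq i (k + 1) hk, 0) = f (crossing hq i k (k.lt_succ_self.trans hk), 1))
    (h2 : ∀ i k (hk : k + 1 < (q i).natAbs),
      f (crossing hq i (k + 1) hk, 3) = f (crossing hq i k (k.lt_succ_self.trans hk), 2))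
    (h3 : ∀ i, f (top hq (finRotate n i), 0) = f (top hq i, 3))
    (h4 : ∀ i k l (hk : k + 1 = (q i).natAbs) (hl : l + 1 = (q (finRotate n i)).natAbs),
      f (crossing hq (finRotate n i) l (by omega), 1) = f (crossing hq i k (by omega), 2))
    (h : (pretzelDiagram q hq).HalfEdge) : f ((pretzelDiagram q hq).glue h) = f h := by
  have hswap : ∀ x y, (pretzelDiagram q hq).glue x = y → f y = f x →
      f ((pretzelDiagram q hq).glue y) = f y := fun x y hxy e => by
    rw [← hxy, (pretzelDiagram q hq).glue_glue, hxy, e]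
  obtain ⟨c, r⟩ := h
  obtain ⟨i, k, hk, rfl⟩ := exists_crossing c
  have h01 : r = 0 ∨ r = 1 ∨ r = 2 ∨ r = 3 := by fin_cases r <;> simp
  rcases h01 with rfl | rfl | rfl | rfl
  · rcases k with _ | k
    · obtain ⟨i, rfl⟩ := (finRotate n).surjective i
      exact hswap _ _ (glue_top i) (h3 i)
    · exact hswap _ _ (glue_left hk) (h1 i k hk)
  · by_cases hk' : k + 1 < (q i).natAbs
    · rw [glue_left hk', h1]
    · obtain ⟨i, rfl⟩ := (finRotate n).surjective i
      have h0 := Int.natAbs_pos.mpr (hq i)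
      exact hswap _ _ (glue_bottom (k := (q i).natAbs - 1) (by omega) (by omega))
        (h4 i _ k (by omega) (by omega))
  · by_cases hk' : k + 1 < (q i).natAbs
    · rw [glue_right hk', h2]
    · have h0 := Int.natAbs_pos.mpr (hq (finRotate n i))
      rw [glue_bottom (l := (q (finRotate n i)).natAbs - 1) (by omega) (by omega)]
      exact h4 i k _ (by omega) (by omega)
  · rcases k with _ | k
    · exact (congrArg f (glue_top i)).trans (h3 i)
    · exact hswap _ _ (glue_right hk) (h2 i k hk)

section Coloring

variable {M : Type*} [AddCommGroup M] [Module ℤ[T;T⁻¹] M]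
  {f : (pretzelDiagram q hq).HalfEdge → M}

theorem coloring_lower (hf : (pretzelDiagram q hq).IsColoring o f) {i : Fin n} {k : ℕ}
    (hk : k < (q i).natAbs) {a b : M}
    (h0 : f (crossing hq i k hk, 0) = a + leftCoeff o i k • (a - b))
    (h3 : f (crossing hq i k hk, 3) = b + rightCoeff o i k • (a - b)) :
    f (crossing hq i k hk, 1) = a + leftCoeff o i (k + 1) • (a - b) ∧
      f (crossing hq i k hk, 2) = b + rightCoeff o i (k + 1) • (a - b) :=
  (crossing_iff f i k hk a b _ rfl h0 h3).1 ⟨hf.overpass _,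
    (relation_iff_crossingWeight f _ (hf.overpass _)).1 (hf.relation _)⟩

theorem coloring_upper (hf : (pretzelDiagram q hq).IsColoring o f) (i : Fin n) (k : ℕ)
    (hk : k < (q i).natAbs) :
    f (crossing hq i k hk, 0) = f (top hq i, 0)
        + leftCoeff o i k • (f (top hq i, 0) - f (top hq i, 3)) ∧
      f (crossing hq i k hk, 3) = f (top hq i, 3)
        + rightCoeff o i k • (f (top hq i, 0) - f (top hq i, 3)) := by
  induction k with
  | zero => simp [top]
  | succ k ih =>
    have h := ih (k.lt_succ_self.trans hk)
    have h' := coloring_lower hf _ h.1 h.2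
    rw [← hf.glue (_, 1), glue_left hk, ← hf.glue (_, 2), glue_right hk] at h'
    exact h'

/-- Matching labels on the bottom arc; the terms without `d` cancel because the top arc already
identifies them. -/
theorem coloring_relation (hf : (pretzelDiagram q hq).IsColoring o f) (i : Fin n) :
    rightCoeff o i (q i).natAbs • (f (top hq i, 0) - f (top hq i, 3))
      = leftCoeff o (finRotate n i) (q (finRotate n i)).natAbs •
        (f (top hq (finRotate n i), 0) - f (top hq (finRotate n i), 3)) := by
  have hpos := fun i => Int.natAbs_pos.mpr (hq i)
  obtain ⟨k, hk⟩ := Nat.exists_eq_add_one.2 (hpos i)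
  obtain ⟨l, hl⟩ := Nat.exists_eq_add_one.2 (hpos (finRotate n i))
  have h1 := coloring_upper hf i k (by omega)
  have h2 := coloring_upper hf (finRotate n i) l (by omega)
  have h1 := (coloring_lower hf _ h1.1 h1.2).2
  have h2 := (coloring_lower hf _ h2.1 h2.2).1
  rw [← hf.glue, glue_bottom hk.symm hl.symm, h2, ← glue_top, hf.glue, add_right_inj] at h1
  rw [hk, hl, ← glue_top, hf.glue, h1]

theorem sum_top_differences (hf : (pretzelDiagram q hq).IsColoring o f) :
    ∑ i, (f (top hq i, 0) - f (top hq i, 3)) = 0 := by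
  rw [Finset.sum_sub_distrib, sub_eq_zero, ← Equiv.sum_comp (finRotate n) fun i => f (top hq i, 0)]
  exact Finset.sum_congr rfl fun i _ => by rw [← glue_top, hf.glue]

end Coloring

end Pretzel

/-! ### Reconstruction of colorings from top differences, and the square presentation. -/

namespace Pretzel

open LinkDiagram

section Existence

variable {m : ℕ} {q : Fin (m + 1) → ℤ} {hq : ∀ i, q i ≠ 0}
  (o : (pretzelDiagram q hq).Orientation)

/-- The total left coefficient of a twist region. -/
noncomputable def leftTotal (i : Fin (m + 1)) : ℤ[T;T⁻¹] := leftCoeff o i (q i).natAbs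

/-- The total right coefficient of a twist region. -/
noncomputable def rightTotal (i : Fin (m + 1)) : ℤ[T;T⁻¹] := rightCoeff o i (q i).natAbs

variable {o}

theorem finRotate_castSucc (i : Fin m) : finRotate (m + 1) i.castSucc = i.succ := by
  rw [finRotate_apply, Fin.coeSucc_eq_succ]

theorem exists_coloring {M : Type*} [AddCommGroup M] [Module ℤ[T;T⁻¹] M] (d : Fin (m + 1) → M)
    (hd : ∑ i, d i = 0)
    (hrel : ∀ i, rightTotal o i • d i = leftTotal o (finRotate _ i) • d (finRotate _ i)) :
    ∃ f : (pretzelDiagram q hq).HalfEdge → M, (pretzelDiagram q hq).IsColoring o f ∧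
      ∀ i, f (top hq i, 0) - f (top hq i, 3) = d i := by
  -- The top left labels are forced by `a (i+1) = a i - d i` once `a 0 = 0`; going round the circle
  -- closes up because `∑ d i = 0`.
  let a : Fin (m + 1) → M := fun i => -∑ j ∈ Finset.Iio i, d j
  have ha : ∀ i, a (finRotate _ i) = a i - d i := by
    intro i
    have h1 : ∑ j ∈ Finset.Iic i, d j = d i + ∑ j ∈ Finset.Iio i, d j := by
      rw [← Finset.Iio_insert, Finset.sum_insert (by simp)]
    have h2 : ∑ j ∈ Finset.Iio (finRotate _ i), d j = ∑ j ∈ Finset.Iic i, d j := by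
      induction i using Fin.lastCases with
      | last =>
        rw [finRotate_last, ← Fin.top_eq_last, Finset.Iic_top, hd]
        exact Finset.sum_eq_zero fun j hj => absurd (Finset.mem_Iio.1 hj) (Fin.not_lt_zero _)
      | cast i =>
        rw [finRotate_castSucc]
        refine Finset.sum_congr ?_ fun _ _ => rfl
        ext j
        simp [Fin.lt_def, Fin.le_def]
    simp only [a, h2, h1]
    abel
  let f : (pretzelDiagram q hq).HalfEdge → M := fun h =>
    ![a h.1.1 + leftCoeff o h.1.1 h.1.2 • d h.1.1,
      a h.1.1 + leftCoeff o h.1.1 (h.1.2 + 1) • d h.1.1,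
      a h.1.1 - d h.1.1 + rightCoeff o h.1.1 (h.1.2 + 1) • d h.1.1,
      a h.1.1 - d h.1.1 + rightCoeff o h.1.1 h.1.2 • d h.1.1] h.2
  have h0 : ∀ i k hk, f (crossing hq i k hk, 0) = a i + leftCoeff o i k • d i :=
    fun _ _ _ => rfl
  have h1 : ∀ i k hk, f (crossing hq i k hk, 1) = a i + leftCoeff o i (k + 1) • d i :=
    fun _ _ _ => rfl
  have h2 : ∀ i k hk, f (crossing hq i k hk, 2) = a i - d i + rightCoeff o i (k + 1) • d i :=
    fun _ _ _ => rfl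
  have h3 : ∀ i k hk, f (crossing hq i k hk, 3) = a i - d i + rightCoeff o i k • d i :=
    fun _ _ _ => rfl
  have hstep := fun i k hk => (crossing_iff (o := o) f i k hk (a i) (a i - d i) (d i)
    (sub_sub_cancel _ _) (h0 i k hk) (h3 i k hk)).2 ⟨h1 i k hk, h2 i k hk⟩
  refine ⟨f, ⟨?_, ?_, ?_⟩, ?_⟩
  · refine glue_invariant f (fun i k hk => by rw [h0, h1]) (fun i k hk => by rw [h3, h2])
      (fun i => ?_) (fun i k l hk hl => ?_)
    · rw [top, top, h0, h3, leftCoeff_zero, rightCoeff_zero, ha, zero_smul, zero_smul]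
    · rw [h1, h2, hk, hl, ha]
      exact congrArg _ (hrel i).symm
  · intro c
    obtain ⟨i, k, hk, rfl⟩ := exists_crossing c
    exact (hstep i k hk).1
  · intro c
    obtain ⟨i, k, hk, rfl⟩ := exists_crossing c
    exact (relation_iff_crossingWeight f _ (hstep i k hk).1).2 (hstep i k hk).2
  · intro i
    rw [top, h0, h3]
    simp

/-- The difference of the two colorings is constant: it passes along the top arcs from one region to
the next, then down each region. -/
theorem coloring_rigid {M : Type*} [AddCommGroup M] [Module ℤ[T;T⁻¹] M]
    {f g : (pretzelDiagram q hq).HalfEdge → M} (hf : (pretzelDiagram q hq).IsColoring o f)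
    (hg : (pretzelDiagram q hq).IsColoring o g)
    (h : ∀ i, f (top hq i, 0) - f (top hq i, 3) = g (top hq i, 0) - g (top hq i, 3))
    (x y : (pretzelDiagram q hq).HalfEdge) : f x - f y = g x - g y := by
  suffices H : ∀ x, f x - g x = f (top hq 0, 0) - g (top hq 0, 0) by
    rw [sub_eq_sub_iff_sub_eq_sub, H x, H y]
  have h3 : ∀ i, f (top hq i, 3) - g (top hq i, 3) = f (top hq i, 0) - g (top hq i, 0) :=
    fun i => by rw [sub_eq_sub_iff_sub_eq_sub, ← neg_inj, neg_sub, neg_sub, ← h i]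
  have htop : ∀ i, f (top hq i, 0) - g (top hq i, 0) = f (top hq 0, 0) - g (top hq 0, 0) := by
    intro i
    induction i using Fin.induction with
    | zero => rfl
    | succ i ih =>
      rw [← ih, ← h3 i.castSucc, ← finRotate_castSucc, ← glue_top, hf.glue, hg.glue]
  rintro ⟨c, r⟩
  obtain ⟨i, k, hk, rfl⟩ := exists_crossing c
  obtain ⟨f0, f3⟩ := coloring_upper hf i k hk
  obtain ⟨g0, g3⟩ := coloring_upper hg i k hk
  obtain ⟨f1, f2⟩ := coloring_lower hf hk f0 f3
  obtain ⟨g1, g2⟩ := coloring_lower hg hk g0 g3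
  rw [← htop i]
  have h01 : r = 0 ∨ r = 1 ∨ r = 2 ∨ r = 3 := by fin_cases r <;> simp
  rcases h01 with rfl | rfl | rfl | rfl
  · rw [f0, g0, h]; abel
  · rw [f1, g1, h]; abel
  · rw [f2, g2, h, ← h3]; abel
  · rw [f3, g3, h, ← h3]; abel

theorem sum_chainMatrix_zero_smul {M : Type*} [AddCommGroup M] [Module ℤ[T;T⁻¹] M]
    (α β : Fin (m + 1) → ℤ[T;T⁻¹]) (d : Fin (m + 1) → M) :
    ∑ v, chainMatrix α β 0 v • d v = ∑ v, d v := by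
  simp [chainMatrix]

theorem sum_chainMatrix_succ_smul {M : Type*} [AddCommGroup M] [Module ℤ[T;T⁻¹] M]
    (α β : Fin (m + 1) → ℤ[T;T⁻¹]) (d : Fin (m + 1) → M) (k : Fin m) :
    ∑ v, chainMatrix α β k.succ v • d v
      = β k.castSucc • d k.castSucc - α k.succ • d k.succ := by
  simp [chainMatrix, sub_smul, Finset.sum_sub_distrib, Pi.single_apply, ite_smul]

/-- The determinant of the chain matrix of a pretzel link is its Alexander polynomial, provided
that a combination of the relations around the diagram shows one of them to be redundant. -/
theorem det_chainMatrix_isAlexanderPolynomial (v w : Fin (m + 1) → ℤ[T;T⁻¹]) (κ : ℤ[T;T⁻¹])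
    (hw : IsUnit (w (Fin.last m))) (hvw : ∀ i, v (finRotate _ i) = w i)
    (hκ : ∀ i, w i * rightTotal o i - v i * leftTotal o i = κ) :
    (pretzelDiagram q hq).IsAlexanderPolynomial o
      (chainMatrix (leftTotal o) (rightTotal o)).det := by
  let P := chainMatrix (leftTotal o) (rightTotal o)
  let d : Fin (m + 1) → RowCokernel P := fun i => Submodule.Quotient.mk (Pi.single i 1)
  have hrow : ∀ u, ∑ v, P u v • d v = 0 := fun u => by
    have h1 : (Submodule.Quotient.mk (P.row u) : RowCokernel P) = 0 :=
      (Submodule.Quotient.mk_eq_zero _).2 (Submodule.subset_span ⟨u, rfl⟩)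
    rw [← h1, pi_eq_sum_univ' (P.row u), ← Submodule.mkQ_apply, map_sum]
    refine Finset.sum_congr rfl fun s _ => ?_
    rw [map_smul]
    rfl
  have hsum : ∑ i, d i = 0 := (sum_chainMatrix_zero_smul _ _ d).symm.trans (hrow 0)
  have hcast : ∀ k : Fin m, rightTotal o k.castSucc • d k.castSucc
      - leftTotal o (finRotate _ k.castSucc) • d (finRotate _ k.castSucc) = 0 := fun k => by
    have h1 := (sum_chainMatrix_succ_smul _ _ d k).symm.trans (hrow k.succ)
    rw [finRotate_castSucc, h1]
  have hrel : ∀ i, rightTotal o i • d i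
      - leftTotal o (finRotate _ i) • d (finRotate _ i) = 0 := by
    intro i
    induction i using Fin.lastCases with
    | cast k => exact hcast k
    | last =>
      -- Reindexing by the rotation collects the coefficient `κ` at every `d i`. All other relations
      -- being known, the unit `w (Fin.last m)` can be cancelled from the last one.
      have h1 : ∑ i, w i • (rightTotal o i • d i
          - leftTotal o (finRotate _ i) • d (finRotate _ i)) = κ • ∑ i, d i := by
        simp only [smul_sub, Finset.sum_sub_distrib, ← hvw, smul_smul]
        rw [Equiv.sum_comp (finRotate _) fun i => (v i * leftTotal o i) • d i,
          ← Finset.sum_sub_distrib, Finset.smul_sum]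
        refine Finset.sum_congr rfl fun i _ => ?_
        rw [hvw, ← sub_smul, hκ]
      rw [Fin.sum_univ_castSucc, hsum, smul_zero] at h1
      simp only [hcast, smul_zero, Finset.sum_const_zero, zero_add] at h1
      exact hw.smul_eq_zero.1 h1
  obtain ⟨c, hc, hcd⟩ := exists_coloring (hq := hq) (o := o) d hsum
    fun i => sub_eq_zero.1 (hrel i)
  have : Nonempty (pretzelDiagram q hq).Crossing := ⟨top hq 0⟩
  refine det_isAlexanderPolynomial P c hc (fun i => (top hq i, 0)) (fun i => (top hq i, 3)) hcd
    ?_ ?_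
  · intro M _ _ f hf u
    induction u using Fin.cases with
    | zero => exact (sum_chainMatrix_zero_smul _ _ _).trans (sum_top_differences hf)
    | succ k =>
      have h1 := coloring_relation hf k.castSucc
      rw [finRotate_castSucc] at h1
      exact (sum_chainMatrix_succ_smul _ _ _ k).trans (sub_eq_zero.2 h1)
  · intro M _ _ f g hf hg h x y
    exact coloring_rigid hf hg h x y

end Existence

end Pretzel

/-! ### Closed forms for constant and for alternating weights. -/

section ColumnSums

variable {R : Type*} [CommRing R]

theorem columnFactor_congr {τ τ' : ℕ → R} {k : ℕ} (h : ∀ j < k, τ j = τ' j) :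
    columnFactor τ k = columnFactor τ' k :=
  Finset.prod_congr rfl fun j hj => by rw [h j (Finset.mem_range.1 hj)]

theorem columnSum_congr {τ τ' : ℕ → R} {k : ℕ} (h : ∀ j < k, τ j = τ' j) :
    columnSum τ k = columnSum τ' k :=
  Finset.sum_congr rfl fun _ hj =>
    columnFactor_congr fun l hl => h l (hl.trans (Finset.mem_range.1 hj))

theorem columnWeightedSum_congr {τ τ' : ℕ → R} {k : ℕ} (h : ∀ j < k, τ j = τ' j) :
    columnWeightedSum τ k = columnWeightedSum τ' k :=
  Finset.sum_congr rfl fun j hj => by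
    rw [h j (Finset.mem_range.1 hj),
      columnFactor_congr fun l hl => h l (hl.trans (Finset.mem_range.1 hj))]

theorem columnFactor_const (x : R) (k : ℕ) : columnFactor (fun _ => x) k = (-x) ^ k := by
  simp [columnFactor]

theorem mul_columnSum_const (x : R) (k : ℕ) :
    (1 + x) * columnSum (fun _ => x) k = 1 - (-x) ^ k := by
  simp only [columnSum, columnFactor_const]
  have := mul_neg_geom_sum (-x) k
  rwa [sub_neg_eq_add] at this

theorem columnWeightedSum_const (x : R) (k : ℕ) :
    columnWeightedSum (fun _ => x) k = x * columnSum (fun _ => x) k := by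
  rw [columnWeightedSum, columnSum, Finset.mul_sum]

theorem columnFactor_alternating {x y : R} (h : x * y = 1) (p : ℕ) :
    columnFactor (fun j => if Even j then x else y) (2 * p) = 1 ∧
      columnFactor (fun j => if Even j then x else y) (2 * p + 1) = -x := by
  have key : columnFactor (fun j => if Even j then x else y) (2 * p) = 1 := by
    induction p with
    | zero => simp [columnFactor]
    | succ p ih =>
      rw [columnFactor] at ih
      rw [columnFactor, mul_add, mul_one, Finset.prod_range_succ, Finset.prod_range_succ, ih]
      simp [h, Nat.not_even_bit1]
  refine ⟨key, ?_⟩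
  rw [columnFactor] at key
  rw [columnFactor, Finset.prod_range_succ, key]
  simp

/-- The factors alternate between `1` and `-x`, starting and ending with `1`. -/
theorem columnSum_alternating {x y : R} (h : x * y = 1) (p : ℕ) :
    columnSum (fun j => if Even j then x else y) (2 * p + 1) = (p + 1) - p * x := by
  induction p with
  | zero => simp [columnSum, columnFactor]
  | succ p ih =>
    rw [columnSum] at ih
    rw [columnSum, Finset.sum_range_succ, mul_add, mul_one, Finset.sum_range_succ, ih,
      (columnFactor_alternating h p).2, ← mul_add_one, (columnFactor_alternating h (p + 1)).1]
    push_cast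
    ring

theorem columnWeightedSum_alternating {x y : R} (h : x * y = 1) (p : ℕ) :
    columnWeightedSum (fun j => if Even j then x else y) (2 * p + 1) = (p + 1) * x - p := by
  have h1 := columnFactor_eq (fun j => if Even j then x else y) (2 * p + 1)
  rw [(columnFactor_alternating h p).2, columnSum_alternating h] at h1
  linear_combination h1

end ColumnSums

/-! ### Expansion in elementary symmetric polynomials. -/

section Symmetric

theorem prod_mul_add_eq_sum_sigmaSym {K : Type*} [CommRing K] {n : ℕ} (q : Fin n → ℤ) (a b : K) :
    ∏ i, ((q i : K) * a + b)
      = ∑ j ∈ Finset.range (n + 1), a ^ j * b ^ (n - j) * (sigmaSym j q : K) := by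
  rw [Finset.prod_add, Finset.sum_powerset, Finset.card_univ, Fintype.card_fin]
  refine Finset.sum_congr rfl fun j _ => ?_
  rw [sigmaSym, Int.cast_sum, Finset.mul_sum]
  refine Finset.sum_congr rfl fun s hs => ?_
  rw [Finset.mem_powersetCard] at hs
  rw [Finset.prod_mul_distrib, Finset.prod_const, Finset.prod_const, hs.2,
    Finset.card_sdiff_of_subset hs.1, hs.2, Finset.card_univ, Fintype.card_fin, Int.cast_prod]
  ring

theorem sum_range_eq_sum_odd {K : Type*} [AddCommMonoid K] (F : ℕ → K) (h : ℕ)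
    (hF : ∀ j, Even j → F j = 0) :
    ∑ j ∈ Finset.range (2 * h + 1), F j = ∑ k ∈ Finset.Icc 1 h, F (2 * k - 1) := by
  induction h with
  | zero => simp [hF]
  | succ h ih =>
    rw [Finset.sum_range_succ, mul_add, mul_one, Finset.sum_range_succ, ih,
      Finset.sum_Icc_succ_top (by omega), hF (2 * h + 2) (by simp [parity_simps]), add_zero]
    rfl

/-- Changing the sign of `b` multiplies the `j`-th term by `(-1) ^ (n - j)`. For even `n` the even
terms cancel, and the odd ones double and contain a factor `b`. -/
theorem prod_sub_prod_eq_sum_sigmaSym {K : Type*} [CommRing K] {n : ℕ} (hn : Even n)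
    (q : Fin n → ℤ) (a b : K) :
    ∏ i, ((q i : K) * a + b) - ∏ i, ((q i : K) * a - b)
      = 2 * b * ∑ k ∈ Finset.Icc 1 (n / 2),
        a ^ (2 * k - 1) * b ^ (n - 2 * k) * (sigmaSym (2 * k - 1) q : K) := by
  obtain ⟨h, rfl⟩ := even_iff_two_dvd.1 hn
  have h1 := prod_mul_add_eq_sum_sigmaSym q a (-b)
  simp only [← sub_eq_add_neg] at h1
  rw [prod_mul_add_eq_sum_sigmaSym, h1, ← Finset.sum_sub_distrib, sum_range_eq_sum_odd]
  · rw [Nat.mul_div_cancel_left _ two_pos, Finset.mul_sum]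
    refine Finset.sum_congr rfl fun k hk => ?_
    rw [Finset.mem_Icc] at hk
    have e : 2 * h - (2 * k - 1) = 2 * (h - k) + 1 := by omega
    have e' : 2 * h - 2 * k = 2 * (h - k) := by omega
    rw [e, e', Odd.neg_pow ⟨_, rfl⟩]
    ring
  · intro j hj
    by_cases hjh : j ≤ 2 * h
    · rw [Even.neg_pow ((Nat.even_sub hjh).2 (by simp [hj])), sub_self]
    -- Beyond the range the truncated exponent is `0`, so both terms still agree.
    · rw [Nat.sub_eq_zero_of_le (by omega)]; simp

end Symmetric

/-! ### Calculus of equality up to units. -/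

section DotEq

theorem DotEq.refl (f : LaurentFrac) : DotEq f f := ⟨0, by simp⟩

theorem DotEq.mul {a b c d : LaurentFrac} (h : DotEq a b) (h' : DotEq c d) :
    DotEq (a * c) (b * d) := by
  obtain ⟨k, h⟩ := h
  obtain ⟨l, h'⟩ := h'
  refine ⟨k + l, ?_⟩
  rw [zpow_add₀ tVar_ne_zero]
  rcases h with rfl | rfl <;> rcases h' with rfl | rfl
  · left; ring
  · right; ring
  · right; ring
  · left; ring

theorem DotEq.trans {a b c : LaurentFrac} (h : DotEq a b) (h' : DotEq b c) : DotEq a c := by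
  obtain ⟨k, h⟩ := h
  obtain ⟨l, h'⟩ := h'
  refine ⟨k + l, ?_⟩
  rw [zpow_add₀ tVar_ne_zero]
  rcases h with rfl | rfl <;> rcases h' with rfl | rfl
  · left; ring
  · right; ring
  · right; ring
  · left; ring

theorem DotEq.prod {ι : Type*} (s : Finset ι) {f g : ι → LaurentFrac}
    (h : ∀ i, DotEq (f i) (g i)) : DotEq (∏ i ∈ s, f i) (∏ i ∈ s, g i) :=
  Finset.prod_hom_rel (DotEq.refl 1) fun i _ _ h' => (h i).mul h'

theorem DotEq.neg_one_pow_mul (m : ℕ) (f : LaurentFrac) : DotEq ((-1) ^ m * f) f := by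
  rcases neg_one_pow_eq_or LaurentFrac m with h | h
  · exact ⟨0, by simp [h]⟩
  · exact ⟨0, by simp [h]⟩

/-- At `t = 1` the value is `2`. -/
theorem tVar_zpow_add_one_ne_zero (k : ℤ) : 1 + tVar ^ k ≠ 0 := by
  have h : (1 + LaurentPolynomial.T k : ℤ[T;T⁻¹]) ≠ 0 := fun h => by
    have := congrArg (LaurentPolynomial.eval₂ (RingHom.id ℤ) 1) h
    rw [map_add, map_one, LaurentPolynomial.eval₂_T] at this
    simp at this
  rw [← algebraMap_T, ← map_one (algebraMap ℤ[T;T⁻¹] LaurentFrac), ← map_add, Ne,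
    FaithfulSMul.algebraMap_eq_zero_iff]
  exact h

theorem two_ne_zero_laurentFrac : (2 : LaurentFrac) ≠ 0 := by
  have := tVar_zpow_add_one_ne_zero 0
  rwa [zpow_zero, one_add_one_eq_two] at this

end DotEq

/-! ### Crossing weights from the orientation. -/

namespace Pretzel

open LinkDiagram

variable {m : ℕ} {q : Fin (m + 1) → ℤ} {hq : ∀ i, q i ≠ 0}
  {o : (pretzelDiagram q hq).Orientation}

theorem outgoing_one (c : (pretzelDiagram q hq).Crossing) :
    o.outgoing (c, 1) = !(o.outgoing (c, 3)) := by
  have := o.outgoing_opposite c 1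
  rw [show (1 + 2 : Fin 4) = 3 from rfl] at this
  rw [this, Bool.not_not]

/-- The weight of a crossing in terms of the directions of its two upper half-edges. -/
theorem weight_eq (i : Fin (m + 1)) (k : ℕ) (hk : k < (q i).natAbs) :
    weight o i k = if 0 < q i then
        (if o.outgoing (crossing hq i k hk, 3) then LaurentPolynomial.T 1
          else LaurentPolynomial.T (-1))
      else (if o.outgoing (crossing hq i k hk, 0) then LaurentPolynomial.T (-1)
        else LaurentPolynomial.T 1) := by
  rw [weight, dif_pos hk, crossingWeight]
  by_cases hpos : 0 < q i
  · have hoc : (pretzelDiagram q hq).overCorner (crossing hq i k hk) = 1 := if_pos hpos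
    rw [hoc, if_pos hpos, outgoing_one]
    cases o.outgoing (crossing hq i k hk, 3) <;> rfl
  · have hoc : (pretzelDiagram q hq).overCorner (crossing hq i k hk) = 0 := if_neg hpos
    rw [hoc, if_neg hpos]

theorem outgoing_succ (i : Fin (m + 1)) (k : ℕ) (hk : k + 1 < (q i).natAbs) :
    o.outgoing (crossing hq i (k + 1) hk, 0)
      = o.outgoing (crossing hq i k (k.lt_succ_self.trans hk), 3) := by
  rw [← glue_left hk, o.outgoing_glue, outgoing_one, Bool.not_not]

theorem outgoing_top_rotate (i : Fin (m + 1)) :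
    o.outgoing (top hq (finRotate _ i), 0) = !(o.outgoing (top hq i, 3)) := by
  rw [← glue_top, o.outgoing_glue]

theorem T_mul_T_neg (s : ℤ) :
    (LaurentPolynomial.T s * LaurentPolynomial.T (-s) : ℤ[T;T⁻¹]) = 1 := by
  rw [← LaurentPolynomial.T_add, add_neg_cancel, LaurentPolynomial.T_zero]

/-! ### Co-directed strands. -/

section CoDirected

/-- The exponent `1` for a twist region that runs upwards and `-1` for one that runs downwards. -/
def direction (o : (pretzelDiagram q hq).Orientation) (i : Fin (m + 1)) : ℤ :=
  if o.outgoing (top hq i, 0) then 1 else -1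

theorem outgoing_of_coDirected (ho : PretzelCoDirected q hq o) (i : Fin (m + 1)) (k : ℕ)
    (hk : k < (q i).natAbs) :
    o.outgoing (crossing hq i k hk, 0) = o.outgoing (top hq i, 0) := by
  induction k with
  | zero => rfl
  | succ k ih => rw [outgoing_succ, ← ho, ih]

theorem weight_of_coDirected (ho : PretzelCoDirected q hq o) (i : Fin (m + 1)) (k : ℕ)
    (hk : k < (q i).natAbs) :
    weight o i k = LaurentPolynomial.T (direction o i * (q i).sign) := by
  rw [weight_eq i k hk, ← ho, outgoing_of_coDirected ho, direction]
  rcases lt_or_gt_of_ne (hq i) with h | h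
  · rw [if_neg h.not_gt, Int.sign_eq_neg_one_of_neg h]
    split_ifs <;> simp
  · rw [if_pos h, Int.sign_eq_one_of_pos h]
    split_ifs <;> simp

/-- The weights in a region are constant, so both sums are geometric with negative ratio; the odd
number of crossings turns `1 - (-x) ^ k` into `1 + x ^ k`. -/
theorem totals_of_coDirected (ho : PretzelCoDirected q hq o) (i : Fin (m + 1))
    (hodd : Odd (q i)) :
    (1 + LaurentPolynomial.T (direction o i)) * leftTotal o i
        = -(1 + LaurentPolynomial.T (direction o i * q i)) ∧
      rightTotal o i = -(LaurentPolynomial.T (direction o i) * leftTotal o i) := by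
  set s := direction o i
  have h1 := columnSum_congr (weight_of_coDirected ho i)
  have h2 := columnWeightedSum_congr (weight_of_coDirected ho i)
  rw [columnWeightedSum_const] at h2
  have h3 := mul_columnSum_const
    (LaurentPolynomial.T (direction o i * (q i).sign) : ℤ[T;T⁻¹]) (q i).natAbs
  rw [(Int.natAbs_odd.2 hodd).neg_pow, sub_neg_eq_add, LaurentPolynomial.T_pow,
    show ((q i).natAbs : ℤ) * (direction o i * (q i).sign) = direction o i * q i by
      rw [mul_left_comm, mul_comm (_ : ℤ) (q i).sign, Int.sign_mul_natAbs]] at h3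
  rw [leftTotal, rightTotal, leftCoeff, rightCoeff, h1, h2]
  rcases lt_or_gt_of_ne (hq i) with h | h
  · rw [if_neg h.not_gt, if_neg h.not_gt]
    rw [Int.sign_eq_neg_one_of_neg h, mul_neg_one] at h3 ⊢
    have h4 := T_mul_T_neg s
    refine ⟨?_, ?_⟩
    · linear_combination -h3 - h4 * columnSum (fun _ => (LaurentPolynomial.T (-s) : ℤ[T;T⁻¹]))
        (q i).natAbs
    · linear_combination - h4 * columnSum (fun _ => (LaurentPolynomial.T (-s) : ℤ[T;T⁻¹]))
        (q i).natAbs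
  · rw [if_pos h, if_pos h]
    rw [Int.sign_eq_one_of_pos h, mul_one] at h3 ⊢
    refine ⟨?_, ?_⟩
    · linear_combination -h3
    · ring

theorem dotEq_of_coDirected (hodd : ∀ i, Odd (q i)) (ho : PretzelCoDirected q hq o) :
    DotEq (algebraMap ℤ[T;T⁻¹] LaurentFrac ((pretzelDiagram q hq).alexanderPolynomial o))
      (1 / (1 + tVar) ^ m * (∏ i, (1 + tVar ^ q i)) *
        ((∑ i, tVar ^ q i / (1 + tVar ^ q i)) - ((m + 1 : ℕ) : LaurentFrac) / 2)) := by
  have ht := tVar_ne_zero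
  have ht1 : 1 + tVar ≠ 0 := by simpa using tVar_zpow_add_one_ne_zero 1
  have hrot : ∀ i, o.outgoing (top hq (finRotate _ i), 0) = !(o.outgoing (top hq i, 0)) :=
    fun i => by rw [outgoing_top_rotate, ho]
  -- The weights must satisfy `v i = -T s * w i`, with `s` the direction of the region. Since
  -- directions alternate, the values `1` and `-T 1` also satisfy `v (i+1) = w i`.
  let w : Fin (m + 1) → ℤ[T;T⁻¹] := fun i =>
    if o.outgoing (top hq i, 0) then 1 else -LaurentPolynomial.T 1
  let v : Fin (m + 1) → ℤ[T;T⁻¹] := fun i =>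
    if o.outgoing (top hq i, 0) then -LaurentPolynomial.T 1 else 1
  have hvw : ∀ i, v (finRotate _ i) = w i := fun i => by
    simp only [v, w, hrot]
    cases o.outgoing (top hq i, 0) <;> rfl
  have hwβ : ∀ i, w i * rightTotal o i = v i * leftTotal o i := fun i => by
    rw [(totals_of_coDirected ho i (hodd i)).2]
    simp only [v, w, direction]
    split_ifs
    · ring
    · linear_combination T_mul_T_neg 1 * leftTotal o i
  have hw : ∀ i, IsUnit (w i) := fun i => by
    simp only [w]
    split_ifs
    · exact isUnit_one
    · exact (LaurentPolynomial.isUnit_T 1).neg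
  have hΔ := dotEq_alexanderPolynomial (det_chainMatrix_isAlexanderPolynomial v w 0 (hw _) hvw
    fun i => sub_eq_zero.2 (hwβ i))
  refine hΔ.trans ?_
  rw [det_chainMatrix, map_mul, map_pow, map_neg, map_one, map_chainSum]
  refine (DotEq.neg_one_pow_mul _ _).trans ?_
  set φ := algebraMap ℤ[T;T⁻¹] LaurentFrac
  have hα : ∀ i, φ (leftTotal o i)
      = -((1 + tVar ^ (direction o i * q i)) / (1 + tVar ^ direction o i)) := fun i => by
    have h1 := congrArg φ (totals_of_coDirected ho i (hodd i)).1
    rw [map_mul, map_neg, map_add, map_add, map_one, algebraMap_T, algebraMap_T] at h1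
    rw [← neg_div, eq_div_iff (tVar_zpow_add_one_ne_zero _), ← h1, mul_comm]
  have hφv : ∀ i, φ (v i) = if o.outgoing (top hq i, 0) then -tVar else 1 := fun i => by
    simp only [v]
    split_ifs
    · rw [map_neg]; rfl
    · exact map_one _
  have hα0 : ∀ i, φ (leftTotal o i) ≠ 0 := fun i => by
    rw [hα]
    exact neg_ne_zero.2 (div_ne_zero (tVar_zpow_add_one_ne_zero _) (tVar_zpow_add_one_ne_zero _))
  rw [chainSum_of_weights (fun i => φ (leftTotal o i)) (fun i => φ (rightTotal o i))
    (fun i => φ (v i)) (fun i => φ (w i)) hα0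
    (fun i => by
      rw [hφv]; split_ifs
      · exact neg_ne_zero.2 ht
      · exact one_ne_zero)
    (fun i => by rw [← map_mul, hwβ, map_mul])
    (fun k => by rw [← hvw, finRotate_castSucc])]
  -- The indicator of the regions running upwards; the alternation of directions makes its sum `n /
  -- 2`, the source of that term in the formula.
  let u : Fin (m + 1) → LaurentFrac := fun i => if o.outgoing (top hq i, 0) then 1 else 0
  have hu : ∑ i, u i = ((m + 1 : ℕ) : LaurentFrac) / 2 := by
    have h1 : ∑ i, u i = ∑ i, (1 - u i) := by
      rw [← Equiv.sum_comp (finRotate _)]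
      refine Finset.sum_congr rfl fun i _ => ?_
      simp only [u, hrot]
      cases o.outgoing (top hq i, 0) <;> simp
    rw [eq_div_iff two_ne_zero_laurentFrac, mul_two]
    nth_rewrite 2 [h1]
    rw [← Finset.sum_add_distrib]
    simp
  have hterm : ∀ i, (φ (v i) * φ (leftTotal o i))⁻¹
      = (1 + tVar) / tVar * (u i - tVar ^ q i / (1 + tVar ^ q i)) := fun i => by
    have h1 := tVar_zpow_add_one_ne_zero (q i)
    have h2 : tVar ^ q i ≠ 0 := zpow_ne_zero _ ht
    rw [hφv, hα]
    simp only [u, direction]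
    split_ifs
    · rw [one_mul, zpow_one]
      field_simp
      ring
    · rw [neg_one_mul, zpow_neg, zpow_neg_one]
      have h3 : tVar ^ q i + 1 ≠ 0 := by rwa [add_comm]
      field_simp
      ring
  have hprod : DotEq (∏ i, φ (leftTotal o i)) (∏ i, ((1 + tVar ^ q i) / (1 + tVar))) := by
    refine DotEq.prod _ fun i => ?_
    have h2 : tVar ^ q i ≠ 0 := zpow_ne_zero _ ht
    rw [hα]
    simp only [direction]
    split_ifs
    · exact ⟨0, Or.inr (by simp)⟩
    · refine ⟨1 - q i, Or.inr ?_⟩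
      rw [neg_one_mul, zpow_neg, zpow_neg_one, zpow_sub₀ ht, zpow_one]
      have h3 : tVar + 1 ≠ 0 := by rwa [add_comm]
      field_simp
      ring
  have hv0 : DotEq (φ (v 0)) 1 := by
    rw [hφv]
    split_ifs
    · exact ⟨1, Or.inr (by simp)⟩
    · exact DotEq.refl _
  -- The factor `(1 + t) / t` of the reciprocal sum gives the unit `t⁻¹` and lowers the power of `1
  -- + t` in the denominator by one; the sign comes from reversing the difference.
  refine ((hv0.mul hprod).mul (DotEq.refl _)).trans ⟨-1, Or.inr ?_⟩
  simp only [hterm]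
  rw [← Finset.mul_sum, Finset.sum_sub_distrib, hu, Finset.prod_div_distrib, Finset.prod_const,
    Finset.card_univ, Fintype.card_fin, pow_succ, zpow_neg_one]
  field_simp
  ring

end CoDirected

/-! ### Oppositely directed strands. -/

section OppositelyDirected

theorem outgoing_three_of_oppositelyDirected (ho : PretzelOppositelyDirected q hq o)
    (c : (pretzelDiagram q hq).Crossing) : o.outgoing (c, 3) = !(o.outgoing (c, 0)) := by
  have := ho c
  revert this
  cases o.outgoing (c, 0) <;> cases o.outgoing (c, 3) <;> simp

theorem outgoing_of_oppositelyDirected (ho : PretzelOppositelyDirected q hq o) (i : Fin (m + 1))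
    (k : ℕ) (hk : k < (q i).natAbs) :
    o.outgoing (crossing hq i k hk, 0)
      = if Even k then o.outgoing (top hq i, 0) else !(o.outgoing (top hq i, 0)) := by
  induction k with
  | zero => rfl
  | succ k ih =>
    rw [outgoing_succ, outgoing_three_of_oppositelyDirected ho, ih]
    by_cases hk : Even k <;> simp [hk, Nat.even_add_one]

theorem outgoing_top_of_oppositelyDirected (ho : PretzelOppositelyDirected q hq o)
    (i : Fin (m + 1)) : o.outgoing (top hq i, 0) = o.outgoing (top hq 0, 0) := by
  induction i using Fin.induction with
  | zero => rfl
  | succ i ih =>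
    rw [← finRotate_castSucc, outgoing_top_rotate, outgoing_three_of_oppositelyDirected ho,
      Bool.not_not, ih]

theorem weight_of_oppositelyDirected (ho : PretzelOppositelyDirected q hq o) (i : Fin (m + 1))
    (k : ℕ) (hk : k < (q i).natAbs) :
    weight o i k = if Even k then LaurentPolynomial.T (-direction o 0)
      else LaurentPolynomial.T (direction o 0) := by
  rw [weight_eq i k hk, outgoing_three_of_oppositelyDirected ho,
    outgoing_of_oppositelyDirected ho, outgoing_top_of_oppositelyDirected ho, direction]
  cases o.outgoing (top hq 0, 0) <;> by_cases hk : Even k <;> simp [hk]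

/-- Weights alternate between inverse units. Changing the sign of `q i` exchanges the two column
sums, so one formula covers both signs. -/
theorem totals_of_oppositelyDirected (ho : PretzelOppositelyDirected q hq o) (i : Fin (m + 1))
    (hodd : Odd (q i)) :
    2 * leftTotal o i = (q i : ℤ[T;T⁻¹]) * (LaurentPolynomial.T (-direction o 0) - 1)
        - (LaurentPolynomial.T (-direction o 0) + 1) ∧
      2 * rightTotal o i = (q i : ℤ[T;T⁻¹]) * (LaurentPolynomial.T (-direction o 0) - 1)
        + (LaurentPolynomial.T (-direction o 0) + 1) := by
  have h1 := columnSum_congr (weight_of_oppositelyDirected ho i)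
  have h2 := columnWeightedSum_congr (weight_of_oppositelyDirected ho i)
  obtain ⟨p, hp⟩ := Int.natAbs_odd.2 hodd
  have hxy : (LaurentPolynomial.T (-direction o 0) * LaurentPolynomial.T (direction o 0) :
      ℤ[T;T⁻¹]) = 1 := by
    rw [mul_comm, T_mul_T_neg]
  rw [leftTotal, rightTotal, leftCoeff, rightCoeff, h1, h2, hp, columnSum_alternating hxy,
    columnWeightedSum_alternating hxy]
  rcases lt_or_gt_of_ne (hq i) with h | h
  · rw [if_neg h.not_gt, if_neg h.not_gt]
    have hqi : q i = -(2 * p + 1) := by omega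
    rw [hqi]
    push_cast
    constructor <;> ring
  · rw [if_pos h, if_pos h]
    have hqi : q i = 2 * p + 1 := by omega
    rw [hqi]
    push_cast
    constructor <;> ring

theorem dotEq_of_oppositelyDirected (hm : Even (m + 1)) (hodd : ∀ i, Odd (q i))
    (ho : PretzelOppositelyDirected q hq o) :
    DotEq (algebraMap ℤ[T;T⁻¹] LaurentFrac ((pretzelDiagram q hq).alexanderPolynomial o))
      (1 / 2 ^ m * ∑ k ∈ Finset.Icc 1 ((m + 1) / 2),
        (tVar - 1) ^ (2 * k - 1) * (tVar + 1) ^ (m + 1 - 2 * k) *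
          (sigmaSym (2 * k - 1) q : LaurentFrac)) := by
  have ht := tVar_ne_zero
  have h2 := two_ne_zero_laurentFrac
  have hinj : Function.Injective (algebraMap ℤ[T;T⁻¹] LaurentFrac) :=
    FaithfulSMul.algebraMap_injective _ _
  have htot := fun i => totals_of_oppositelyDirected ho i (hodd i)
  have hκ : ∀ i, rightTotal o i - leftTotal o i = LaurentPolynomial.T (-direction o 0) + 1 := by
    intro i
    apply hinj
    apply mul_left_cancel₀ h2
    rw [← map_ofNat (algebraMap ℤ[T;T⁻¹] LaurentFrac) 2, ← map_mul, ← map_mul]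
    refine congrArg _ ?_
    linear_combination (htot i).2 - (htot i).1
  have hΔ := dotEq_alexanderPolynomial (det_chainMatrix_isAlexanderPolynomial (o := o)
    (fun _ => 1) (fun _ => 1) _ isUnit_one (fun _ => rfl)
    fun i => (by rw [one_mul, one_mul]; exact hκ i))
  refine hΔ.trans ?_
  rw [det_chainMatrix, map_mul, map_pow, map_neg, map_one]
  refine (DotEq.neg_one_pow_mul _ _).trans ?_
  have hS := congrArg (algebraMap ℤ[T;T⁻¹] LaurentFrac)
    (mul_chainSum_of_sub_eq (leftTotal o) (rightTotal o) _ hκ)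
  set φ := algebraMap ℤ[T;T⁻¹] LaurentFrac
  set x := tVar ^ (-direction o 0) with hx
  rw [map_mul, map_sub, map_prod, map_prod, map_add, map_one, algebraMap_T, ← hx] at hS
  have hl : ∀ i, 2 * φ (leftTotal o i) = (q i : LaurentFrac) * (x - 1) - (x + 1) := fun i => by
    have := congrArg φ (htot i).1
    simpa only [map_mul, map_sub, map_add, map_one, map_ofNat, map_intCast, φ, algebraMap_T, ← hx]
      using this
  have hr : ∀ i, 2 * φ (rightTotal o i) = (q i : LaurentFrac) * (x - 1) + (x + 1) := fun i => by
    have := congrArg φ (htot i).2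
    simpa only [map_mul, map_sub, map_add, map_one, map_ofNat, map_intCast, φ, algebraMap_T, ← hx]
      using this
  have hx1 : x + 1 ≠ 0 := by rw [add_comm]; exact tVar_zpow_add_one_ne_zero _
  have hmain : φ (chainSum (leftTotal o) (rightTotal o))
      = 1 / 2 ^ m * ∑ k ∈ Finset.Icc 1 ((m + 1) / 2),
        (x - 1) ^ (2 * k - 1) * (x + 1) ^ (m + 1 - 2 * k) *
          (sigmaSym (2 * k - 1) q : LaurentFrac) := by
    -- Applied to `2 * L i` and `2 * R i`, this evaluates `2 ^ (m + 1) * (x + 1) * chainSum`;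
    -- cancelling `2 * (x + 1)` leaves the claim.
    have h3 := prod_sub_prod_eq_sum_sigmaSym hm q (x - 1) (x + 1)
    simp only [← hl, ← hr, Finset.prod_mul_distrib, Finset.prod_const, Finset.card_univ,
      Fintype.card_fin] at h3
    rw [← mul_sub, ← hS] at h3
    have h4 : 2 * (x + 1) ≠ 0 := mul_ne_zero h2 hx1
    rw [one_div, eq_inv_mul_iff_mul_eq₀ (pow_ne_zero _ h2)]
    apply mul_left_cancel₀ h4
    rw [← h3]
    ring
  rw [hmain]
  rcases (by rw [direction]; split_ifs <;> simp : direction o 0 = 1 ∨ direction o 0 = -1)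
    with hd | hd
  -- For `x = t⁻¹` each linear factor contributes `t⁻¹`, and `x - 1` also a sign. Every term has
  -- degree `m` in these factors and odd degree in `x - 1`, whence the common unit `-t ^ (-m)`.
  · refine ⟨-m, Or.inr ?_⟩
    rw [mul_left_comm, ← mul_neg, Finset.mul_sum (Finset.Icc _ _) _ (tVar ^ (-m : ℤ)),
      ← Finset.sum_neg_distrib]
    congr 1
    refine Finset.sum_congr rfl fun k hk => ?_
    rw [Finset.mem_Icc] at hk
    have hx' : x = tVar⁻¹ := by rw [hx, hd, zpow_neg_one]
    have e1 : tVar⁻¹ - 1 = -(tVar⁻¹ * (tVar - 1)) := by field_simp; ring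
    have e2 : tVar⁻¹ + 1 = tVar⁻¹ * (tVar + 1) := by field_simp; ring
    have e3 : tVar ^ (-m : ℤ) = tVar⁻¹ ^ (2 * k - 1) * tVar⁻¹ ^ (m + 1 - 2 * k) := by
      rw [← pow_add, zpow_neg, zpow_natCast, inv_pow]
      congr 2
      omega
    rw [hx', e1, e2, e3, Odd.neg_pow (by rw [Nat.odd_iff]; omega), mul_pow, mul_pow]
    ring
  · have hx' : x = tVar := by rw [hx, hd, neg_neg, zpow_one]
    rw [hx']
    exact DotEq.refl _

end OppositelyDirected

end Pretzel

theorem mainTheorem5 (n : ℕ) (hn : 0 < n) (hn_even : Even n) (q : Fin n → ℤ)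
    (hq_odd : ∀ i, Odd (q i)) (hq : ∀ i, q i ≠ 0)
    (o : (pretzelDiagram q hq).Orientation) :
    (PretzelCoDirected q hq o →
      DotEq (algebraMap ℤ[T;T⁻¹] LaurentFrac ((pretzelDiagram q hq).alexanderPolynomial o))
        (1 / (1 + tVar) ^ (n - 1) * (∏ i, (1 + tVar ^ q i)) *
          ((∑ i, tVar ^ q i / (1 + tVar ^ q i)) - (n : LaurentFrac) / 2))) ∧
    (PretzelOppositelyDirected q hq o →
      DotEq (algebraMap ℤ[T;T⁻¹] LaurentFrac ((pretzelDiagram q hq).alexanderPolynomial o))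
        (1 / 2 ^ (n - 1) * ∑ k ∈ Finset.Icc 1 (n / 2),
          (tVar - 1) ^ (2 * k - 1) * (tVar + 1) ^ (n - 2 * k) *
            (sigmaSym (2 * k - 1) q : LaurentFrac))) := by
  obtain ⟨m, rfl⟩ := Nat.exists_eq_add_one.2 hn
  exact ⟨Pretzel.dotEq_of_coDirected hq_odd,
    Pretzel.dotEq_of_oppositelyDirected hn_even hq_odd⟩
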